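/- A \emph{P-module} is a triple $(A,B,\mathfrak H)$ with $\mathfrak H$ a complex Hilbert space and $A,B\in B(\mathfrak H)$ such that $A^*A+B^*B=\mathrm{id}$. A \emph{morphism} $\theta:(A,B,\mathfrak H)\to(A',B',\mathfrak H')$ is a bounded linear map with $\theta A=A'\theta$ and $\theta B=B'\theta$; unitary equivalence means that there is a unitary morphism. A \emph{sub-module} is a closed subspace invariant under $A$ and $B$, with the restricted operators. It is \emph{complete} if its orthogonal complement contains no nonzero sub-module. A P-module is \emph{indecomposable} if it does not contain two mutually orthogonal nonzero sub-modules. It is \emph{diffuse} if $p_n\cdots p_1\xi\to 0$ for every $\xi\in\mathfrak H$ and every sequence $(p_n)_{n\ge1}$ in $\{A,B\}$. For a P-module $(A,B,\mathfrak H)$ and a finite rooted binary tree $t$ let $\mathfrak H_t$ be the Hilbert space of maps from the leaves of $t$ to $\mathfrak H$. Growing a caret at a leaf decorated by $\xi$ replaces $\xi$ by $A\xi$ (left) and $B\xi$ (right); this defines a directed system of isometries, and $\mathscr H$ is the completion of its direct limit. It contains $\mathfrak H$ (trivial tree). For $i=0,1$ let $\tau_i$ be the operator on $\mathscr H$ that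 takes a decorated tree, grown if necessary, to its left ($i=0$) or right ($i=1$) decorated sub-tree. Then $(\tau_0,\tau_1,\mathscr H)$ is a P-module, and $s_i\mapsto\tau_i^*$ defines a representation of the Cuntz algebra $\mathcal O=C^*(s_0,s_1\mid s_0^*s_0=s_1^*s_1=s_0s_0^*+s_1s_1^*=1)$ on $\mathscr H$. Restricting it along the usual embedding of Thompson's group $V$ in the unitary group of $\mathcal O$ (a prefix replacement $\mu_j w\mapsto\nu_j w$ is sent to $\sum_j s_{\nu_j}s_{\mu_j}^*$) and to $F\subset T\subset V$ gives the Pythagorean representations $\sigma^X$ of $X=F,T,V,\mathcal O$ on $\mathscr H$. An intertwiner is a bounded linear map that intertwines the actions. \textbf{Theorem B.} Let $(A_1,B_1,\mathfrak H_1)$ and $(A_2,B_2,\mathfrak H_2)$ be diffuse, finite-dimensional P-modules with associated representations $\sigma_i^X$ of $X=F,T,V,\mathcal O$ on $\mathscr H_i$, $i=1,2$. Let $\mathfrak H_{i,\mathrm{small}}$ be the smallest complete sub-module of the P-module $\mathscr H_i$, i.e. the intersection of all its complete sub-modules; it is itself a complete sub-module of $\mathscr H_i$ and is contained in $\mathfrak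 H_i$. Then, for each $X=F,T,V,\mathcal O$: \begin{enumerate} \item If $\mathfrak H_1\ne0$, then $\sigma_1^X$ is irreducible if and only if the P-module $(A_1,B_1,\mathfrak H_1)$ is indecomposable. \item Every intertwiner $\Theta:\mathscr H_1\to\mathscr H_2$ from $\sigma_1^X$ to $\sigma_2^X$ restricts to a P-module morphism $\theta:\mathfrak H_{1,\mathrm{small}}\to\mathfrak H_{2,\mathrm{small}}$. The representations $\sigma_1^X$ and $\sigma_2^X$ are unitarily equivalent if and only if the P-modules $\mathfrak H_{1,\mathrm{small}}$ and $\mathfrak H_{2,\mathrm{small}}$ are unitarily equivalent. \end{enumerate} -/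

import Mathlib

open scoped InnerProductSpace

namespace Pythagorean

noncomputable section

set_option linter.unusedSectionVars false

/-! ### Finite rooted binary trees -/

/-- Finite rooted planar binary trees: the trivial tree, or a root with a left and a right subtree. -/
inductive BTree : Type
  | leaf : BTree
  | node (l r : BTree) : BTree

namespace BTree

/-- The set of leaves of a tree. -/
inductive Leaf : BTree → Type
  | root : Leaf BTree.leaf
  | inl {l r : BTree} (v : Leaf l) : Leaf (BTree.node l r)
  | inr {l r : BTree} (v : Leaf r) : Leaf (BTree.node l r)

/-- The trivial tree has one leaf. -/
def leafEquiv : Unit ≃ leaf.Leaf where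
  toFun _ := Leaf.root
  invFun _ := ()
  left_inv _ := rfl
  right_inv v := by cases v; rfl

/-- The leaves of a nontrivial tree. -/
def nodeEquiv (l r : BTree) : l.Leaf ⊕ r.Leaf ≃ (node l r).Leaf where
  toFun v := match v with
    | Sum.inl v => Leaf.inl v
    | Sum.inr v => Leaf.inr v
  invFun v := match v with
    | Leaf.inl v => Sum.inl v
    | Leaf.inr v => Sum.inr v
  left_inv v := by cases v <;> rfl
  right_inv v := by cases v <;> rfl

instance instFintypeLeaf : (t : BTree) → Fintype t.Leaf
  | leaf => Fintype.ofEquiv Unit leafEquiv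
  | node l r =>
      letI := instFintypeLeaf l
      letI := instFintypeLeaf r
      Fintype.ofEquiv (l.Leaf ⊕ r.Leaf) (nodeEquiv l r)

theorem sum_leaf {M : Type*} [AddCommMonoid M] (f : leaf.Leaf → M) : ∑ v, f v = f Leaf.root := by
  rw [← leafEquiv.sum_comp]
  simp [leafEquiv]

theorem sum_node {M : Type*} [AddCommMonoid M] {l r : BTree} (f : (node l r).Leaf → M) :
    ∑ v, f v = ∑ v, f (Leaf.inl v) + ∑ v, f (Leaf.inr v) := by
  rw [← (nodeEquiv l r).sum_comp, Fintype.sum_sum_type]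
  rfl

/-- The finite binary string of a leaf (`false` is the digit `0`, a left turn, and `true` is the
digit `1`, a right turn), read from the root to the leaf. -/
def addr : (t : BTree) → t.Leaf → List Bool
  | leaf, _ => []
  | node l _, Leaf.inl v => false :: addr l v
  | node _ r, Leaf.inr v => true :: addr r v

/-- `t.le s` means that `t` is a rooted subtree of `s`, i.e. `s = f ∘ t` for some forest `f`. -/
protected def le : BTree → BTree → Prop
  | leaf, _ => True
  | node _ _, leaf => False
  | node l r, node l' r' => BTree.le l l' ∧ BTree.le r r'

theorem le_refl' : ∀ t : BTree, t.le t
  | leaf => trivial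
  | node l r => ⟨le_refl' l, le_refl' r⟩

theorem le_trans' : ∀ t s u : BTree, t.le s → s.le u → t.le u
  | leaf, _, _, _, _ => trivial
  | node _ _, leaf, _, h, _ => h.elim
  | node _ _, node _ _, leaf, _, h => h.elim
  | node l r, node l' r', node l'' r'', h, h' =>
      ⟨le_trans' l l' l'' h.1 h'.1, le_trans' r r' r'' h.2 h'.2⟩

instance : Preorder BTree where
  le := BTree.le
  le_refl := le_refl'
  le_trans := le_trans'

theorem leaf_le (t : BTree) : leaf ≤ t := trivial

theorem node_le_node {l r l' r' : BTree} : node l r ≤ node l' r' ↔ l ≤ l' ∧ r ≤ r' := Iff.rfl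

theorem not_node_le_leaf {l r : BTree} : ¬ node l r ≤ leaf := fun h => h

theorem exists_upper : ∀ t s : BTree, ∃ u, t ≤ u ∧ s ≤ u
  | leaf, s => ⟨s, leaf_le s, le_refl s⟩
  | node l r, leaf => ⟨node l r, le_refl _, leaf_le _⟩
  | node l r, node l' r' =>
      let ⟨u, h₁, h₂⟩ := exists_upper l l'
      let ⟨v, h₃, h₄⟩ := exists_upper r r'
      ⟨node u v, ⟨h₁, h₃⟩, ⟨h₂, h₄⟩⟩

instance : IsDirectedOrder BTree := ⟨exists_upper⟩

instance : Nonempty BTree := ⟨leaf⟩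

end BTree

/-! ### Pythagorean modules -/

section Modules

variable (H : Type*) [NormedAddCommGroup H] [InnerProductSpace ℂ H] [CompleteSpace H]

/-- A Pythagorean module (P-module) on the complex Hilbert space `H`: two bounded operators `A`, `B`
with `A* A + B* B = 1`. -/
structure PModule where
  /-- the first operator -/
  A : H →L[ℂ] H
  /-- the second operator -/
  B : H →L[ℂ] H
  /-- the Pythagorean equality -/
  pythagoras : A.adjoint ∘L A + B.adjoint ∘L B = ContinuousLinearMap.id ℂ H

end Modules

namespace PModule

open BTree

variable {H : Type*} [NormedAddCommGroup H] [InnerProductSpace ℂ H] [CompleteSpace H]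
variable (m : PModule H)

/-- `m.op false = A` and `m.op true = B`. -/
def op : Bool → H →L[ℂ] H
  | false => m.A
  | true => m.B

/-- The operator of a finite binary string, the first letter acting first. -/
def word : List Bool → H →L[ℂ] H
  | [] => ContinuousLinearMap.id ℂ H
  | i :: w => word w ∘L m.op i

theorem inner_op (x y : H) :
    ⟪m.op false x, m.op false y⟫_ℂ + ⟪m.op true x, m.op true y⟫_ℂ = ⟪x, y⟫_ℂ := by
  have h := congrArg (fun T : H →L[ℂ] H => ⟪x, T y⟫_ℂ) m.pythagoras
  simpa [inner_add_right, ContinuousLinearMap.adjoint_inner_right, op] using h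

/-- The connecting map from decorations of `t` to decorations of a larger tree `s`: a caret attached
to a leaf decorated by `x` gets the decorations `A x` (left) and `B x` (right). Only meaningful for
`t ≤ s`. -/
def connect : (t s : BTree) → (t.Leaf → H) →ₗ[ℂ] (s.Leaf → H)
  | leaf, s => LinearMap.pi fun v =>
      (m.word (s.addr v)).toLinearMap ∘ₗ LinearMap.proj (φ := fun _ : leaf.Leaf => H) Leaf.root
  | node _ _, leaf => 0
  | node l r, node l' r' => LinearMap.pi fun v => match v with
      | Leaf.inl v => LinearMap.proj v ∘ₗ connect l l' ∘ₗ LinearMap.funLeft ℂ H Leaf.inl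
      | Leaf.inr v => LinearMap.proj v ∘ₗ connect r r' ∘ₗ LinearMap.funLeft ℂ H Leaf.inr

@[simp] theorem connect_leaf (s : BTree) (ξ : leaf.Leaf → H) (v : s.Leaf) :
    m.connect leaf s ξ v = m.word (s.addr v) (ξ Leaf.root) := by
  cases s <;> rfl

@[simp] theorem connect_inl (l r l' r' : BTree) (ξ : (node l r).Leaf → H) (v : l'.Leaf) :
    m.connect (node l r) (node l' r') ξ (Leaf.inl v) = m.connect l l' (fun u => ξ (Leaf.inl u)) v := rfl

@[simp] theorem connect_inr (l r l' r' : BTree) (ξ : (node l r).Leaf → H) (v : r'.Leaf) :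
    m.connect (node l r) (node l' r') ξ (Leaf.inr v) = m.connect r r' (fun u => ξ (Leaf.inr u)) v := rfl

theorem connect_self : ∀ (t : BTree) (ξ : t.Leaf → H), m.connect t t ξ = ξ
  | leaf, ξ => by
      funext v
      cases v
      rfl
  | node l r, ξ => by
      funext v
      rcases v with v | v
      · rw [connect_inl, connect_self]
      · rw [connect_inr, connect_self]

theorem connect_word : ∀ (t s : BTree) (_ : t ≤ s) (x : H) (v : s.Leaf),
    m.connect t s (fun u => m.word (t.addr u) x) v = m.word (s.addr v) x
  | leaf, s, _, x, v => by
      rw [connect_leaf]; rfl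
  | node _ _, leaf, h, _, _ => (not_node_le_leaf h).elim
  | node l r, node l' r', h, x, v => by
      cases v with
      | inl v => rw [connect_inl]; exact connect_word l l' h.1 (m.op false x) v
      | inr v => rw [connect_inr]; exact connect_word r r' h.2 (m.op true x) v

theorem connect_connect : ∀ (t s u : BTree) (_ : t ≤ s) (_ : s ≤ u) (ξ : t.Leaf → H),
    m.connect s u (m.connect t s ξ) = m.connect t u ξ
  | leaf, s, u, _, h, ξ => by
      funext v
      rw [connect_leaf, ← m.connect_word s u h]
      congr 2
  | node _ _, leaf, _, h, _, _ => (not_node_le_leaf h).elim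
  | node _ _, node _ _, leaf, _, h, _ => (not_node_le_leaf h).elim
  | node l r, node l' r', node l'' r'', h, h', ξ => by
      funext v
      rcases v with v | v
      · simp only [connect_inl]
        rw [connect_connect l l' l'' h.1 h'.1]
      · simp only [connect_inr]
        rw [connect_connect r r' r'' h.2 h'.2]

/-- The inner product of two decorations of the same tree. -/
def treeInner (t : BTree) (ξ η : t.Leaf → H) : ℂ := ∑ v, ⟪ξ v, η v⟫_ℂ

theorem treeInner_leaf (ξ η : leaf.Leaf → H) : treeInner leaf ξ η = ⟪ξ Leaf.root, η Leaf.root⟫_ℂ :=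
  sum_leaf _

theorem treeInner_node (l r : BTree) (ξ η : (node l r).Leaf → H) :
    treeInner (node l r) ξ η = treeInner l (fun v => ξ (Leaf.inl v)) (fun v => η (Leaf.inl v)) +
      treeInner r (fun v => ξ (Leaf.inr v)) (fun v => η (Leaf.inr v)) :=
  sum_node _

theorem treeInner_word : ∀ (s : BTree) (x y : H),
    treeInner s (fun v => m.word (s.addr v) x) (fun v => m.word (s.addr v) y) = ⟪x, y⟫_ℂ
  | leaf, x, y => by rw [treeInner_leaf]; rfl
  | node l r, x, y => by
      rw [treeInner_node, ← m.inner_op x y, ← treeInner_word l, ← treeInner_word r]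
      rfl

theorem treeInner_connect : ∀ (t s : BTree) (_ : t ≤ s) (ξ η : t.Leaf → H),
    treeInner t ξ η = treeInner s (m.connect t s ξ) (m.connect t s η)
  | leaf, s, _, ξ, η => by
      rw [treeInner_leaf, ← m.treeInner_word s]
      congr 1
  | node _ _, leaf, h, _, _ => (not_node_le_leaf h).elim
  | node l r, node l' r', h, ξ, η => by
      rw [treeInner_node, treeInner_node, treeInner_connect l l' h.1, treeInner_connect r r' h.2]
      rfl

/-- The connecting maps, as a family indexed by pairs `t ≤ s`. -/
abbrev connectLE (t s : BTree) (_ : t ≤ s) : (t.Leaf → H) →ₗ[ℂ] (s.Leaf → H) := m.connect t s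

instance : DirectedSystem (fun t : BTree => t.Leaf → H) (fun t s h => m.connectLE t s h) where
  map_self t ξ := m.connect_self t ξ
  map_map _ _ _ h h' ξ := m.connect_connect _ _ _ h h' ξ

/-- The direct limit over all trees `t` of the spaces of decorations of the leaves of `t`. -/
def PreLim : Type _ := DirectLimit (fun t : BTree => t.Leaf → H) m.connectLE

instance : AddCommGroup m.PreLim :=
  inferInstanceAs (AddCommGroup (DirectLimit (fun t : BTree => t.Leaf → H) m.connectLE))

instance : Module ℂ m.PreLim :=
  inferInstanceAs (Module ℂ (DirectLimit (fun t : BTree => t.Leaf → H) m.connectLE))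

/-- The class `[t, ξ]` of a decorated tree. -/
def cls (t : BTree) (ξ : t.Leaf → H) : m.PreLim :=
  (⟦⟨t, ξ⟩⟧ : DirectLimit (fun t : BTree => t.Leaf → H) m.connectLE)

theorem cls_connect {t s : BTree} (h : t ≤ s) (ξ : t.Leaf → H) :
    m.cls s (m.connect t s ξ) = m.cls t ξ :=
  DirectLimit.mk_apply (F := fun t : BTree => t.Leaf → H) (f := m.connectLE) t s ξ h

theorem cls_add (t : BTree) (ξ η : t.Leaf → H) : m.cls t (ξ + η) = m.cls t ξ + m.cls t η :=
  (DirectLimit.add_def (G := fun t : BTree => t.Leaf → H) (f := m.connectLE) t ξ η).symm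

theorem cls_smul (t : BTree) (c : ℂ) (ξ : t.Leaf → H) : m.cls t (c • ξ) = c • m.cls t ξ :=
  (DirectLimit.smul_def (G := fun t : BTree => t.Leaf → H) (f := m.connectLE) t ξ c).symm

theorem cls_zero (t : BTree) : m.cls t 0 = 0 :=
  (DirectLimit.zero_def (G := fun t : BTree => t.Leaf → H) (f := m.connectLE) t).symm

theorem exists_cls (x : m.PreLim) : ∃ t ξ, x = m.cls t ξ :=
  DirectLimit.exists_eq_mk m.connectLE x

theorem exists_cls₂ (x y : m.PreLim) : ∃ t ξ η, x = m.cls t ξ ∧ y = m.cls t η :=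
  DirectLimit.exists_eq_mk₂ m.connectLE x y

/-- Linear maps out of the direct limit. -/
def liftLin {E : Type*} [AddCommGroup E] [Module ℂ E] (φ : ∀ t : BTree, (t.Leaf → H) →ₗ[ℂ] E)
    (hφ : ∀ t s (_ : t ≤ s) ξ, φ t ξ = φ s (m.connect t s ξ)) : m.PreLim →ₗ[ℂ] E where
  toFun := DirectLimit.lift m.connectLE (fun t ξ => φ t ξ) hφ
  map_add' x y := by
    obtain ⟨t, ξ, η, rfl, rfl⟩ := m.exists_cls₂ x y
    rw [← cls_add]
    exact (φ t).map_add ξ η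
  map_smul' c x := by
    obtain ⟨t, ξ, rfl⟩ := m.exists_cls x
    rw [← cls_smul]
    exact (φ t).map_smul c ξ

@[simp] theorem liftLin_cls {E : Type*} [AddCommGroup E] [Module ℂ E]
    (φ : ∀ t : BTree, (t.Leaf → H) →ₗ[ℂ] E)
    (hφ : ∀ t s (_ : t ≤ s) ξ, φ t ξ = φ s (m.connect t s ξ)) (t : BTree) (ξ : t.Leaf → H) :
    m.liftLin φ hφ (m.cls t ξ) = φ t ξ := rfl

/-- The inner product of the direct limit, `⟪[t, ξ], [t, η]⟫ = ∑ v, ⟪ξ v, η v⟫`. -/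
def preInner (x y : m.PreLim) : ℂ :=
  DirectLimit.lift₂ m.connectLE m.connectLE (fun t ξ η => treeInner t ξ η)
    (fun t s h ξ η => m.treeInner_connect t s h ξ η) x y

theorem preInner_cls (t : BTree) (ξ η : t.Leaf → H) :
    m.preInner (m.cls t ξ) (m.cls t η) = treeInner t ξ η :=
  DirectLimit.lift₂_def (F₁ := fun t : BTree => t.Leaf → H)
    (F₂ := fun t : BTree => t.Leaf → H) m.connectLE m.connectLE _ _ t ξ η

/-- The direct limit is a pre-Hilbert space. -/
abbrev preCore : InnerProductSpace.Core ℂ m.PreLim where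
  inner := m.preInner
  conj_inner_symm x y := by
    obtain ⟨t, ξ, η, rfl, rfl⟩ := m.exists_cls₂ x y
    rw [preInner_cls, preInner_cls, treeInner, treeInner, map_sum]
    exact Finset.sum_congr rfl fun v _ => inner_conj_symm _ _
  re_inner_nonneg x := by
    obtain ⟨t, ξ, rfl⟩ := m.exists_cls x
    rw [preInner_cls, treeInner, map_sum]
    exact Finset.sum_nonneg fun v _ => inner_self_nonneg
  add_left x y z := by
    obtain ⟨t, ξ, η, rfl, rfl⟩ := m.exists_cls₂ x y
    obtain ⟨s, ζ, rfl⟩ := m.exists_cls z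
    obtain ⟨u, h, h'⟩ := exists_upper t s
    rw [← m.cls_connect h ξ, ← m.cls_connect h η, ← m.cls_connect h' ζ, ← cls_add]
    simp only [preInner_cls, treeInner, Pi.add_apply, inner_add_left, Finset.sum_add_distrib]
  smul_left x y c := by
    obtain ⟨t, ξ, η, rfl, rfl⟩ := m.exists_cls₂ x y
    rw [← cls_smul]
    simp only [preInner_cls, treeInner, Pi.smul_apply, inner_smul_left, Finset.mul_sum]
  definite x hx := by
    obtain ⟨t, ξ, rfl⟩ := m.exists_cls x
    rw [preInner_cls, treeInner] at hx
    have h : ξ = 0 := by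
      have h₁ : ∑ v, ‖ξ v‖ ^ 2 = 0 := by
        have := congrArg Complex.re hx
        rw [Complex.re_sum] at this
        simpa [inner_self_eq_norm_sq_to_K, ← Complex.ofReal_pow] using this
      funext v
      have h₂ := (Finset.sum_eq_zero_iff_of_nonneg (fun v _ => sq_nonneg ‖ξ v‖)).1 h₁ v
        (Finset.mem_univ v)
      simpa using h₂
    rw [h, cls_zero]

instance : NormedAddCommGroup m.PreLim := m.preCore.toNormedAddCommGroup

instance : InnerProductSpace ℂ m.PreLim := InnerProductSpace.ofCore m.preCore.toCore

theorem inner_cls (t : BTree) (ξ η : t.Leaf → H) :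
    ⟪m.cls t ξ, m.cls t η⟫_ℂ = ∑ v, ⟪ξ v, η v⟫_ℂ := m.preInner_cls t ξ η

/-- The Hilbert space of the P-module: the completion of the direct limit. -/
abbrev Lim : Type _ := UniformSpace.Completion m.PreLim

/-! ### The partial isometries `τ` and the action of the Cuntz algebra -/

/-- `ξ ↦ [t, ξ]` as a linear map. -/
def clsLin (t : BTree) : (t.Leaf → H) →ₗ[ℂ] m.PreLim where
  toFun := m.cls t
  map_add' := m.cls_add t
  map_smul' := m.cls_smul t

/-- Snipping a decorated tree at the left (`false`) or right (`true`) child of the root; the trivial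
tree first has to be grown by one caret. -/
def snipTree : Bool → (t : BTree) → (t.Leaf → H) →ₗ[ℂ] m.PreLim
  | i, leaf => m.clsLin leaf ∘ₗ LinearMap.pi fun _ =>
      (m.op i).toLinearMap ∘ₗ LinearMap.proj (φ := fun _ : leaf.Leaf => H) Leaf.root
  | false, node l _ => m.clsLin l ∘ₗ LinearMap.funLeft ℂ H Leaf.inl
  | true, node _ r => m.clsLin r ∘ₗ LinearMap.funLeft ℂ H Leaf.inr

theorem snipTree_leaf (i : Bool) (ξ : leaf.Leaf → H) :
    m.snipTree i leaf ξ = m.cls leaf (fun _ => m.op i (ξ Leaf.root)) := by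
  cases i <;> rfl

theorem snipTree_false (l r : BTree) (ξ : (node l r).Leaf → H) :
    m.snipTree false (node l r) ξ = m.cls l (fun v => ξ (Leaf.inl v)) := rfl

theorem snipTree_true (l r : BTree) (ξ : (node l r).Leaf → H) :
    m.snipTree true (node l r) ξ = m.cls r (fun v => ξ (Leaf.inr v)) := rfl

theorem snipTree_connect (i : Bool) : ∀ (t s : BTree) (_ : t ≤ s) (ξ : t.Leaf → H),
    m.snipTree i t ξ = m.snipTree i s (m.connect t s ξ)
  | leaf, leaf, _, ξ => by rw [connect_self]
  | leaf, node l r, _, ξ => by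
      cases i
      · rw [snipTree_leaf, snipTree_false, ← m.cls_connect (leaf_le l)]
        congr 1
      · rw [snipTree_leaf, snipTree_true, ← m.cls_connect (leaf_le r)]
        congr 1
  | node _ _, leaf, h, _ => (not_node_le_leaf h).elim
  | node l r, node l' r', h, ξ => by
      cases i
      · rw [snipTree_false, snipTree_false]
        exact (m.cls_connect h.1 _).symm
      · rw [snipTree_true, snipTree_true]
        exact (m.cls_connect h.2 _).symm

/-- Snipping, on the direct limit. -/
def snip (i : Bool) : m.PreLim →ₗ[ℂ] m.PreLim :=
  m.liftLin (m.snipTree i) (m.snipTree_connect i)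

theorem snip_cls (i : Bool) (t : BTree) (ξ : t.Leaf → H) :
    m.snip i (m.cls t ξ) = m.snipTree i t ξ := rfl

theorem inner_snip (x y : m.PreLim) :
    ⟪m.snip false x, m.snip false y⟫_ℂ + ⟪m.snip true x, m.snip true y⟫_ℂ = ⟪x, y⟫_ℂ := by
  obtain ⟨t, ξ, η, rfl, rfl⟩ := m.exists_cls₂ x y
  cases t with
  | leaf =>
      simp only [snip_cls, snipTree_leaf, inner_cls, sum_leaf]
      exact m.inner_op _ _
  | node l r =>
      simp only [snip_cls, snipTree_false, snipTree_true, inner_cls]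
      exact (treeInner_node l r ξ η).symm

theorem norm_sq_snip (x : m.PreLim) : ‖m.snip false x‖ ^ 2 + ‖m.snip true x‖ ^ 2 = ‖x‖ ^ 2 := by
  have h := congrArg Complex.re (m.inner_snip x x)
  simpa [inner_self_eq_norm_sq_to_K, ← Complex.ofReal_pow] using h

theorem norm_snip_le (i : Bool) (x : m.PreLim) : ‖m.snip i x‖ ≤ 1 * ‖x‖ := by
  rw [one_mul]
  refine le_of_sq_le_sq ?_ (norm_nonneg x)
  rw [← m.norm_sq_snip x]
  cases i
  · exact le_add_of_nonneg_right (sq_nonneg _)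
  · exact le_add_of_nonneg_left (sq_nonneg _)

/-- The partial isometry `τ₀` (for `false`) or `τ₁` (for `true`) of the Hilbert space of `m`. -/
def tau (i : Bool) : m.Lim →L[ℂ] m.Lim :=
  ((m.snip i).mkContinuous 1 (m.norm_snip_le i)).completion

@[simp] theorem tau_coe (i : Bool) (x : m.PreLim) : m.tau i (x : m.Lim) = (m.snip i x : m.PreLim) :=
  ContinuousLinearMap.completion_apply_coe _ x

theorem inner_tau (x y : m.Lim) :
    ⟪m.tau false x, m.tau false y⟫_ℂ + ⟪m.tau true x, m.tau true y⟫_ℂ = ⟪x, y⟫_ℂ := by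
  refine UniformSpace.Completion.induction_on₂ x y (isClosed_eq (by fun_prop) (by fun_prop)) ?_
  intro x y
  simp only [tau_coe, UniformSpace.Completion.inner_coe]
  exact m.inner_snip x y

theorem tau_pythagoras : (m.tau false).adjoint ∘L m.tau false + (m.tau true).adjoint ∘L m.tau true =
    ContinuousLinearMap.id ℂ m.Lim := by
  ext1 x
  refine ext_inner_left ℂ fun y => ?_
  simpa [inner_add_right, ContinuousLinearMap.adjoint_inner_right] using m.inner_tau y x

/-- The P-module `(τ₀, τ₁)` on the Hilbert space of `m`. -/
def lim : PModule m.Lim where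
  A := m.tau false
  B := m.tau true
  pythagoras := m.tau_pythagoras

/-- The copy of `H` inside the Hilbert space of `m`: the decorations of the trivial tree. -/
def embed : H →ₗ[ℂ] m.Lim :=
  (UniformSpace.Completion.toComplL (𝕜 := ℂ) (E := m.PreLim)).toLinearMap ∘ₗ
    m.clsLin leaf ∘ₗ LinearMap.pi fun _ => LinearMap.id

/-- Attaching a decorated tree at the left (`false`) or right (`true`) child of the root, with
decoration `0` at the other child. -/
def attachTree : Bool → (t : BTree) → (t.Leaf → H) →ₗ[ℂ] m.PreLim
  | false, t => m.clsLin (node t leaf) ∘ₗ LinearMap.pi fun v => match v with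
      | Leaf.inl v => LinearMap.proj v
      | Leaf.inr _ => 0
  | true, t => m.clsLin (node leaf t) ∘ₗ LinearMap.pi fun v => match v with
      | Leaf.inl _ => 0
      | Leaf.inr v => LinearMap.proj v

theorem attachTree_connect (i : Bool) (t s : BTree) (h : t ≤ s) (ξ : t.Leaf → H) :
    m.attachTree i t ξ = m.attachTree i s (m.connect t s ξ) := by
  cases i
  · refine (m.cls_connect (t := node t leaf) (s := node s leaf) ⟨h, leaf_le _⟩ _).symm.trans ?_
    refine congrArg (m.cls (node s leaf)) (funext fun v => ?_)
    rcases v with v | v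
    · rfl
    · rw [connect_inr, connect_leaf]
      exact map_zero _
  · refine (m.cls_connect (t := node leaf t) (s := node leaf s) ⟨leaf_le _, h⟩ _).symm.trans ?_
    refine congrArg (m.cls (node leaf s)) (funext fun v => ?_)
    rcases v with v | v
    · rw [connect_inl, connect_leaf]
      exact map_zero _
    · rfl

/-- Attaching, on the direct limit. -/
def attach (i : Bool) : m.PreLim →ₗ[ℂ] m.PreLim :=
  m.liftLin (m.attachTree i) (m.attachTree_connect i)

theorem snip_attach (i j : Bool) (x : m.PreLim) :
    m.snip j (m.attach i x) = if i = j then x else 0 := by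
  obtain ⟨t, ξ, rfl⟩ := m.exists_cls x
  cases i <;> cases j
  · rfl
  · exact m.cls_zero leaf
  · exact m.cls_zero leaf
  · rfl

theorem norm_attach_le (i : Bool) (x : m.PreLim) : ‖m.attach i x‖ ≤ 1 * ‖x‖ := by
  rw [one_mul]
  refine le_of_sq_le_sq ?_ (norm_nonneg x)
  rw [← m.norm_sq_snip (m.attach i x)]
  cases i <;> simp [snip_attach]

/-- Attaching, on the Hilbert space. -/
def graftOp (i : Bool) : m.Lim →L[ℂ] m.Lim :=
  ((m.attach i).mkContinuous 1 (m.norm_attach_le i)).completion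

@[simp] theorem graftOp_coe (i : Bool) (x : m.PreLim) :
    m.graftOp i (x : m.Lim) = (m.attach i x : m.PreLim) :=
  ContinuousLinearMap.completion_apply_coe _ x

theorem tau_graftOp (i j : Bool) (x : m.Lim) :
    m.tau j (m.graftOp i x) = if i = j then x else 0 := by
  refine UniformSpace.Completion.induction_on x (isClosed_eq (by fun_prop) ?_) ?_
  · split_ifs <;> fun_prop
  · intro x
    rw [graftOp_coe, tau_coe, snip_attach]
    split_ifs <;> simp

theorem adjoint_tau (i : Bool) : (m.tau i).adjoint = m.graftOp i := by
  ext1 x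
  have h := congrArg (fun T : m.Lim →L[ℂ] m.Lim => T (m.graftOp i x)) m.tau_pythagoras
  simp only [add_apply, ContinuousLinearMap.comp_apply, tau_graftOp] at h
  cases i <;> simpa using h

end PModule

/-! ### Representations of the Cuntz algebra -/

section Cuntz

variable (K : Type*) [NormedAddCommGroup K] [InnerProductSpace ℂ K] [CompleteSpace K]

/-- A representation on the Hilbert space `K` of the Cuntz algebra, the universal C*-algebra
generated by `s₀`, `s₁` with `s₀* s₀ = s₁* s₁ = s₀ s₀* + s₁ s₁* = 1`: by universality, this is a pair
of operators with these relations, the images of `s₀` (for `false`) and `s₁` (for `true`). -/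
structure CuntzRep where
  /-- the images of the two generators -/
  S : Bool → K →L[ℂ] K
  /-- `s_i* s_i = 1` -/
  isometry : ∀ i, (S i).adjoint ∘L S i = ContinuousLinearMap.id ℂ K
  /-- `s₀ s₀* + s₁ s₁* = 1` -/
  sum_eq_one : S false ∘L (S false).adjoint + S true ∘L (S true).adjoint =
    ContinuousLinearMap.id ℂ K

end Cuntz

/-- The representation `s_i ↦ τ_i*` of the Cuntz algebra associated with a P-module. -/
def PModule.cuntz {H : Type*} [NormedAddCommGroup H] [InnerProductSpace ℂ H] [CompleteSpace H]
    (m : PModule H) : CuntzRep m.Lim where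
  S i := (m.tau i).adjoint
  isometry i := by
    ext1 x
    rw [ContinuousLinearMap.adjoint_adjoint, PModule.adjoint_tau]
    simp [PModule.tau_graftOp]
  sum_eq_one := by
    simp only [ContinuousLinearMap.adjoint_adjoint]
    exact m.tau_pythagoras

/-! ### Thompson's groups -/

namespace BTree

/-- Attaching a tree at every leaf of a tree. -/
def graft : (t : BTree) → (t.Leaf → BTree) → BTree
  | leaf, f => f Leaf.root
  | node l r, f => node (graft l fun v => f (Leaf.inl v)) (graft r fun v => f (Leaf.inr v))

theorem exists_graft : ∀ t s : BTree, t ≤ s → ∃ f, s = graft t f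
  | leaf, s, _ => ⟨fun _ => s, rfl⟩
  | node _ _, leaf, h => (not_node_le_leaf h).elim
  | node l r, node l' r', h => by
      obtain ⟨f, hf⟩ := exists_graft l l' h.1
      obtain ⟨g, hg⟩ := exists_graft r r' h.2
      refine ⟨fun v => match v with
        | Leaf.inl v => f v
        | Leaf.inr v => g v, ?_⟩
      rw [hf, hg]
      rfl

/-- The leaf of `graft t f` given by a leaf `v` of `t` and a leaf of `f v`. -/
def graftLeaf : (t : BTree) → (f : t.Leaf → BTree) → (Σ v, (f v).Leaf) → (graft t f).Leaf
  | leaf, _, ⟨Leaf.root, u⟩ => u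
  | node l _, f, ⟨Leaf.inl v, u⟩ => Leaf.inl (graftLeaf l (fun v => f (Leaf.inl v)) ⟨v, u⟩)
  | node _ r, f, ⟨Leaf.inr v, u⟩ => Leaf.inr (graftLeaf r (fun v => f (Leaf.inr v)) ⟨v, u⟩)

theorem addr_graftLeaf : ∀ (t : BTree) (f : t.Leaf → BTree) (p : Σ v, (f v).Leaf),
    (graft t f).addr (graftLeaf t f p) = t.addr p.1 ++ (f p.1).addr p.2
  | leaf, _, ⟨Leaf.root, _⟩ => rfl
  | node l _, f, ⟨Leaf.inl v, u⟩ =>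
      congrArg (List.cons false) (addr_graftLeaf l (fun v => f (Leaf.inl v)) ⟨v, u⟩)
  | node _ r, f, ⟨Leaf.inr v, u⟩ =>
      congrArg (List.cons true) (addr_graftLeaf r (fun v => f (Leaf.inr v)) ⟨v, u⟩)

theorem graftLeaf_surjective : ∀ (t : BTree) (f : t.Leaf → BTree),
    Function.Surjective (graftLeaf t f)
  | leaf, _, u => ⟨⟨Leaf.root, u⟩, rfl⟩
  | node l r, f, u => by
      cases u with
      | inl u =>
          obtain ⟨⟨v, w⟩, h⟩ := graftLeaf_surjective l _ u
          exact ⟨⟨Leaf.inl v, w⟩, congrArg Leaf.inl h⟩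
      | inr u =>
          obtain ⟨⟨v, w⟩, h⟩ := graftLeaf_surjective r _ u
          exact ⟨⟨Leaf.inr v, w⟩, congrArg Leaf.inr h⟩

theorem graftLeaf_injective : ∀ (t : BTree) (f : t.Leaf → BTree),
    Function.Injective (graftLeaf t f)
  | leaf, _, ⟨Leaf.root, _⟩, ⟨Leaf.root, _⟩, h => by cases h; rfl
  | node l r, f, ⟨Leaf.inl v, u⟩, ⟨Leaf.inl v', u'⟩, h => by
      have := graftLeaf_injective l _ (Leaf.inl.inj h)
      cases this; rfl
  | node l r, f, ⟨Leaf.inr v, u⟩, ⟨Leaf.inr v', u'⟩, h => by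
      have := graftLeaf_injective r _ (Leaf.inr.inj h)
      cases this; rfl
  | node l r, f, ⟨Leaf.inl v, u⟩, ⟨Leaf.inr v', u'⟩, h => by cases h
  | node l r, f, ⟨Leaf.inr v, u⟩, ⟨Leaf.inl v', u'⟩, h => by cases h

/-- The leaves of `graft t f`. -/
def graftEquiv (t : BTree) (f : t.Leaf → BTree) : (Σ v, (f v).Leaf) ≃ (graft t f).Leaf :=
  Equiv.ofBijective (graftLeaf t f) ⟨graftLeaf_injective t f, graftLeaf_surjective t f⟩

theorem addr_graftEquiv (t : BTree) (f : t.Leaf → BTree) (p : Σ v, (f v).Leaf) :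
    (graft t f).addr (graftEquiv t f p) = t.addr p.1 ++ (f p.1).addr p.2 := addr_graftLeaf t f p

/-- Every sufficiently long binary string passes through a leaf. -/
theorem exists_prefix : ∀ t : BTree, ∃ N : ℕ, ∀ w : List Bool, N ≤ w.length →
    ∃ v u, w = t.addr v ++ u
  | leaf => ⟨0, fun w _ => ⟨Leaf.root, w, rfl⟩⟩
  | node l r => by
      obtain ⟨N, hN⟩ := exists_prefix l
      obtain ⟨M, hM⟩ := exists_prefix r
      refine ⟨max N M + 1, fun w hw => ?_⟩
      match w, hw with
      | false :: w, hw =>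
          simp only [List.length_cons] at hw
          obtain ⟨v, u, h⟩ := hN w (by omega)
          exact ⟨Leaf.inl v, u, congrArg (List.cons false) h⟩
      | true :: w, hw =>
          simp only [List.length_cons] at hw
          obtain ⟨v, u, h⟩ := hM w (by omega)
          exact ⟨Leaf.inr v, u, congrArg (List.cons true) h⟩

end BTree

open BTree

/-- The Cantor space of infinite binary strings. -/
abbrev Cantor : Type := Stream' Bool

/-- `g` is the transformation of the Cantor space encoded by the trees `s`, `t` and the bijection `κ`
between their leaves: it replaces the prefix `v` by `κ v`, for every leaf `v` of `s`. -/
def Represents (g : Equiv.Perm Cantor) (s t : BTree) (κ : s.Leaf ≃ t.Leaf) : Prop :=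
  ∀ (v : s.Leaf) (x : Cantor), g (s.addr v ++ₛ x) = t.addr (κ v) ++ₛ x

theorem Represents.inv {g : Equiv.Perm Cantor} {s t : BTree} {κ : s.Leaf ≃ t.Leaf}
    (h : Represents g s t κ) : Represents g⁻¹ t s κ.symm := fun v x => by
  rw [Equiv.Perm.inv_eq_iff_eq, h, Equiv.apply_symm_apply]

theorem Represents.expand {g : Equiv.Perm Cantor} {s t : BTree} {κ : s.Leaf ≃ t.Leaf}
    (h : Represents g s t κ) {r : BTree} (hr : s ≤ r) :
    ∃ (t' : BTree) (κ' : r.Leaf ≃ t'.Leaf), Represents g r t' κ' := by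
  obtain ⟨f, rfl⟩ := exists_graft s r hr
  let e : (Σ u, (f (κ.symm u)).Leaf) ≃ (graft s f).Leaf :=
    (Equiv.sigmaCongrLeft (β := fun v => (f v).Leaf) κ.symm).trans (graftEquiv s f)
  refine ⟨graft t (fun u => f (κ.symm u)), e.symm.trans (graftEquiv t _), fun v x => ?_⟩
  obtain ⟨⟨u, w⟩, rfl⟩ := e.surjective v
  have he : (graft s f).addr (e ⟨u, w⟩) = s.addr (κ.symm u) ++ (f (κ.symm u)).addr w :=
    addr_graftEquiv s f ⟨κ.symm u, w⟩
  rw [he, Stream'.append_append_stream, h, Equiv.apply_symm_apply, Equiv.trans_apply,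
    Equiv.symm_apply_apply, addr_graftEquiv, Stream'.append_append_stream]

theorem Represents.mul {g h : Equiv.Perm Cantor} {s t u : BTree} {κ : s.Leaf ≃ t.Leaf}
    {κ' : t.Leaf ≃ u.Leaf} (hh : Represents h s t κ) (hg : Represents g t u κ') :
    Represents (g * h) s u (κ.trans κ') := fun v x => by
  rw [Equiv.Perm.mul_apply, hh, hg, Equiv.trans_apply]

/-- Thompson's group `V`, as a group of transformations of the Cantor space. -/
def thompsonV : Subgroup (Equiv.Perm Cantor) where
  carrier := {g | ∃ (s t : BTree) (κ : s.Leaf ≃ t.Leaf), Represents g s t κ}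
  one_mem' := ⟨leaf, leaf, Equiv.refl _, fun _ _ => rfl⟩
  inv_mem' := fun ⟨s, t, κ, h⟩ => ⟨t, s, κ.symm, h.inv⟩
  mul_mem' := by
    rintro g h ⟨s₁, t₁, κ₁, h₁⟩ ⟨s₂, t₂, κ₂, h₂⟩
    obtain ⟨r, hr, hr'⟩ := exists_upper s₁ t₂
    obtain ⟨u, κ, hu⟩ := h₁.expand hr
    obtain ⟨w, κ', hw⟩ := h₂.inv.expand hr'
    exact ⟨w, u, _, (by simpa using hw.inv : Represents h w r κ'.symm).mul hu⟩

/-- The lexicographic order of the Cantor space. -/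
def LexLT (x y : Cantor) : Prop :=
  ∃ n, (∀ k < n, x.get k = y.get k) ∧ x.get n = false ∧ y.get n = true

/-- The cyclic order of the Cantor space. -/
def CycLT (x y z : Cantor) : Prop :=
  (LexLT x y ∧ LexLT y z) ∨ (LexLT y z ∧ LexLT z x) ∨ (LexLT z x ∧ LexLT x y)

/-- Thompson's group `T`: the elements of `V` that preserve the cyclic order, i.e. those whose
bijection between the leaves of two trees is cyclic. -/
def thompsonT : Subgroup (Equiv.Perm Cantor) where
  carrier := {g | g ∈ thompsonV ∧ ∀ x y z, CycLT (g x) (g y) (g z) ↔ CycLT x y z}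
  one_mem' := ⟨one_mem _, fun _ _ _ => Iff.rfl⟩
  inv_mem' := fun ⟨h, h'⟩ => ⟨inv_mem h, fun x y z => by
    rw [← h']
    simp⟩
  mul_mem' := fun ⟨h, h'⟩ ⟨k, k'⟩ => ⟨mul_mem h k, fun x y z => by
    simp only [Equiv.Perm.mul_apply, h', k']⟩

/-- Thompson's group `F`: the elements of `V` that preserve the order, i.e. those whose bijection
between the leaves of two trees is increasing from left to right. -/
def thompsonF : Subgroup (Equiv.Perm Cantor) where
  carrier := {g | g ∈ thompsonV ∧ ∀ x y, LexLT (g x) (g y) ↔ LexLT x y}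
  one_mem' := ⟨one_mem _, fun _ _ => Iff.rfl⟩
  inv_mem' := fun ⟨h, h'⟩ => ⟨inv_mem h, fun x y => by
    rw [← h']
    simp⟩
  mul_mem' := fun ⟨h, h'⟩ ⟨k, k'⟩ => ⟨mul_mem h k, fun x y => by
    simp only [Equiv.Perm.mul_apply, h', k']⟩

theorem thompsonT_le : thompsonT ≤ thompsonV := fun _ h => h.1

theorem thompsonF_le : thompsonF ≤ thompsonT := fun _ h => ⟨h.1, fun x y z => by
  simp only [CycLT, h.2]⟩

/-! ### From the Cuntz algebra to the Thompson groups -/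

namespace CuntzRep

variable {K : Type*} [NormedAddCommGroup K] [InnerProductSpace ℂ K] [CompleteSpace K]
variable (c : CuntzRep K)

/-- The operator `S_w = S_{w₁} S_{w₂} ⋯` of a finite binary string `w = w₁ w₂ ⋯`. -/
def word : List Bool → K →L[ℂ] K
  | [] => ContinuousLinearMap.id ℂ K
  | i :: w => c.S i ∘L word w

theorem word_append (u w : List Bool) (x : K) : c.word (u ++ w) x = c.word u (c.word w x) := by
  induction u with
  | nil => rfl
  | cons i u ih => exact congrArg (c.S i) ih

theorem adjoint_S_S (i : Bool) (x : K) : (c.S i).adjoint (c.S i x) = x :=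
  congrArg (fun T : K →L[ℂ] K => T x) (c.isometry i)

theorem sum_S (x : K) :
    c.S false ((c.S false).adjoint x) + c.S true ((c.S true).adjoint x) = x :=
  congrArg (fun T : K →L[ℂ] K => T x) c.sum_eq_one

theorem adjoint_S_S_not (i : Bool) (x : K) : (c.S i).adjoint (c.S (!i) x) = 0 := by
  have h := congrArg (c.S i).adjoint (c.sum_S (c.S (!i) x))
  cases i <;> simpa [adjoint_S_S] using h

theorem adjoint_id_apply (x : K) :
    (c.word []).adjoint x = x := by
  change (ContinuousLinearMap.id ℂ K).adjoint x = x
  rw [← ContinuousLinearMap.one_def, ← ContinuousLinearMap.star_eq_adjoint, star_one]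
  rfl

theorem adjoint_word_word (t : BTree) (v : t.Leaf) (x : K) :
    (c.word (t.addr v)).adjoint (c.word (t.addr v) x) = x := by
  induction v with
  | root => exact c.adjoint_id_apply x
  | inl v ih => simpa [addr, word, adjoint_S_S, ContinuousLinearMap.adjoint_comp] using ih
  | inr v ih => simpa [addr, word, adjoint_S_S, ContinuousLinearMap.adjoint_comp] using ih

theorem adjoint_word_word_of_ne (t : BTree) (u v : t.Leaf) (huv : u ≠ v) (x : K) :
    (c.word (t.addr u)).adjoint (c.word (t.addr v) x) = 0 := by
  induction u with
  | root => cases v; exact (huv rfl).elim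
  | inl u ih =>
      cases v with
      | inl v =>
          have := ih v (fun h => huv (h ▸ rfl))
          simpa [addr, word, adjoint_S_S, ContinuousLinearMap.adjoint_comp] using this
      | inr v =>
          have := c.adjoint_S_S_not false
          simp at this
          simp [addr, word, this, ContinuousLinearMap.adjoint_comp]
  | inr u ih =>
      cases v with
      | inl v =>
          have := c.adjoint_S_S_not true
          simp at this
          simp [addr, word, this, ContinuousLinearMap.adjoint_comp]
      | inr v =>
          have := ih v (fun h => huv (h ▸ rfl))
          simpa [addr, word, adjoint_S_S, ContinuousLinearMap.adjoint_comp] using this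

theorem sum_word : ∀ (t : BTree) (x : K),
    ∑ v, c.word (t.addr v) ((c.word (t.addr v)).adjoint x) = x
  | leaf, x => by rw [sum_leaf]; exact c.adjoint_id_apply x
  | node l r, x => by
      rw [sum_node]
      simp only [addr, word, ContinuousLinearMap.adjoint_comp, ContinuousLinearMap.comp_apply]
      rw [← map_sum, ← map_sum, sum_word l, sum_word r, c.sum_S]

/-- The operator `∑ v, S_{κ v} S_v*`, the sum being over the leaves `v` of `s`. -/
def diagramOp (s t : BTree) (κ : s.Leaf ≃ t.Leaf) : K →L[ℂ] K :=
  ∑ v, c.word (t.addr (κ v)) ∘L (c.word (s.addr v)).adjoint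

theorem diagramOp_word (s t : BTree) (κ : s.Leaf ≃ t.Leaf) (v : s.Leaf) (x : K) :
    c.diagramOp s t κ (c.word (s.addr v) x) = c.word (t.addr (κ v)) x := by
  rw [diagramOp, sum_apply, Finset.sum_eq_single v]
  · simp [adjoint_word_word]
  · intro u _ hu
    simp [adjoint_word_word_of_ne c s u v hu]
  · simp

theorem adjoint_diagramOp (s t : BTree) (κ : s.Leaf ≃ t.Leaf) :
    (c.diagramOp s t κ).adjoint = c.diagramOp t s κ.symm := by
  rw [diagramOp, diagramOp, map_sum, ← κ.sum_comp]
  simp [ContinuousLinearMap.adjoint_comp]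

/-- An operator is determined by its values on the words of a given length. -/
theorem eq_of_words (N : ℕ) (T T' : K →L[ℂ] K) : ∀ μ μ' : List Bool,
    (∀ w : List Bool, w.length = N → ∀ x, T (c.word (μ ++ w) x) = T' (c.word (μ' ++ w) x)) →
    ∀ x, T (c.word μ x) = T' (c.word μ' x) := by
  induction N with
  | zero =>
      intro μ μ' h x
      simpa using h [] rfl x
  | succ N ih =>
      intro μ μ' h x
      have key : ∀ i y, T (c.word μ (c.S i y)) = T' (c.word μ' (c.S i y)) := fun i y => by
        have := ih (μ ++ [i]) (μ' ++ [i]) (fun w hw x => by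
          simpa using h (i :: w) (by simp [hw]) x) y
        simpa [word_append, word] using this
      rw [← c.sum_S x]
      simp only [map_add, key]

theorem append_injective : ∀ {u w : List Bool}, (∀ x : Cantor, u ++ₛ x = w ++ₛ x) → u = w
  | [], [], _ => rfl
  | i :: u, j :: w, h => by
      have h₁ : i = j := congrArg (fun x : Cantor => x.get 0) (h (Stream'.const true))
      have h₂ : u = w := append_injective fun x => congrArg Stream'.tail (h x)
      rw [h₁, h₂]
  | [], j :: _, h => by
      have h₁ : (!j) = j := congrArg (fun x : Cantor => x.get 0) (h (Stream'.const (!j)))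
      cases j <;> cases h₁
  | i :: _, [], h => by
      have h₁ : i = (!i) := congrArg (fun x : Cantor => x.get 0) (h (Stream'.const (!i)))
      cases i <;> cases h₁

theorem diagramOp_of_represents {g : Equiv.Perm Cantor} {s t : BTree} {κ : s.Leaf ≃ t.Leaf}
    (h : Represents g s t κ) {μ ν : List Bool} (hg : ∀ x : Cantor, g (μ ++ₛ x) = ν ++ₛ x) (x : K) :
    c.diagramOp s t κ (c.word μ x) = c.word ν x := by
  obtain ⟨N, hN⟩ := exists_prefix s
  refine c.eq_of_words N (c.diagramOp s t κ) (ContinuousLinearMap.id ℂ K) μ ν (fun w hw x => ?_) x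
  obtain ⟨v, u, hv⟩ := hN (μ ++ w) (by simp [hw])
  have : t.addr (κ v) ++ u = ν ++ w := append_injective fun y => by
    rw [Stream'.append_append_stream, ← h, ← Stream'.append_append_stream, ← hv,
      Stream'.append_append_stream, hg, Stream'.append_append_stream]
  rw [hv, word_append, diagramOp_word, ← word_append, this]
  rfl

theorem eq_of_leaves (t : BTree) {T T' : K →L[ℂ] K}
    (h : ∀ v x, T (c.word (t.addr v) x) = T' (c.word (t.addr v) x)) : T = T' := by
  ext x
  rw [← c.sum_word t x, map_sum, map_sum]
  exact Finset.sum_congr rfl fun v _ => h v _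

/-- The image of an element of `V` under the embedding of `V` in the unitary group of the Cuntz
algebra: the operator `∑ v, S_{κ v} S_v*` for any choice of trees and bijection that encodes it. -/
def opV (g : thompsonV) : K →L[ℂ] K :=
  c.diagramOp g.2.choose g.2.choose_spec.choose g.2.choose_spec.choose_spec.choose

theorem opV_word (g : thompsonV) {μ ν : List Bool}
    (hg : ∀ x : Cantor, (g : Equiv.Perm Cantor) (μ ++ₛ x) = ν ++ₛ x) (x : K) :
    c.opV g (c.word μ x) = c.word ν x :=
  c.diagramOp_of_represents g.2.choose_spec.choose_spec.choose_spec hg x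

theorem opV_eq (g : thompsonV) {s t : BTree} {κ : s.Leaf ≃ t.Leaf} (h : Represents g s t κ) :
    c.opV g = c.diagramOp s t κ :=
  c.eq_of_leaves s fun v x => by rw [c.opV_word g (h v), diagramOp_word]

theorem opV_one : c.opV 1 = 1 := by
  ext x
  exact c.opV_word 1 (μ := []) (ν := []) (fun _ => rfl) x

theorem opV_mul (g h : thompsonV) : c.opV (g * h) = c.opV g * c.opV h := by
  obtain ⟨s, t, κ, hh⟩ := h.2
  obtain ⟨s', t', κ', hg⟩ := g.2
  obtain ⟨N, hN⟩ := exists_prefix s'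
  refine c.eq_of_leaves s fun v x => ?_
  rw [mul_apply_eq_comp, c.opV_word h (hh v)]
  refine c.eq_of_words N _ _ _ _ (fun w hw x => ?_) x
  obtain ⟨v', u, hv⟩ := hN (t.addr (κ v) ++ w) (by simp [hw])
  have h₁ : ∀ x : Cantor,
      (g : Equiv.Perm Cantor) ((t.addr (κ v) ++ w) ++ₛ x) = (t'.addr (κ' v') ++ u) ++ₛ x := by
    intro x
    rw [hv, Stream'.append_append_stream, hg, Stream'.append_append_stream]
  rw [c.opV_word g h₁, c.opV_word (g * h) (ν := t'.addr (κ' v') ++ u)]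
  intro x
  rw [Subgroup.coe_mul, Equiv.Perm.mul_apply, Stream'.append_append_stream, hh,
    ← Stream'.append_append_stream, h₁]

theorem adjoint_opV (g : thompsonV) : (c.opV g).adjoint = c.opV g⁻¹ := by
  obtain ⟨s, t, κ, h⟩ := g.2
  rw [c.opV_eq g h, adjoint_diagramOp, c.opV_eq g⁻¹ h.inv]

/-- The restriction of a representation of the Cuntz algebra to Thompson's group `V`. -/
def onV : thompsonV →* unitary (K →L[ℂ] K) where
  toFun g := ⟨c.opV g, by
    rw [Unitary.mem_iff, ContinuousLinearMap.star_eq_adjoint, adjoint_opV, ← opV_mul, ← opV_mul,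
      inv_mul_cancel, mul_inv_cancel, opV_one]
    exact ⟨rfl, rfl⟩⟩
  map_one' := Subtype.ext c.opV_one
  map_mul' g h := Subtype.ext (c.opV_mul g h)

end CuntzRep

/-! ### Representations, intertwiners and irreducibility -/

section Representations

variable {ι K K' : Type*} [NormedAddCommGroup K] [InnerProductSpace ℂ K]
variable [NormedAddCommGroup K'] [InnerProductSpace ℂ K']

/-- `Θ` intertwines two families of operators with the same index set. -/
def Intertwines (ρ : ι → K →L[ℂ] K) (ρ' : ι → K' →L[ℂ] K') (Θ : K →L[ℂ] K') : Prop :=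
  ∀ i, Θ ∘L ρ i = ρ' i ∘L Θ

/-- Unitary equivalence of two families of operators with the same index set. -/
def UnitarilyEquivalent (ρ : ι → K →L[ℂ] K) (ρ' : ι → K' →L[ℂ] K') : Prop :=
  ∃ U : K ≃ₗᵢ[ℂ] K', ∀ i x, U (ρ i x) = ρ' i (U x)

/-- Irreducibility: the space is nonzero and has no closed invariant subspaces but the trivial two. -/
def IsIrreducible (ρ : ι → K →L[ℂ] K) : Prop :=
  Nontrivial K ∧ ∀ L : Submodule ℂ K, IsClosed (L : Set K) → (∀ i, ∀ x ∈ L, ρ i x ∈ L) →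
    L = ⊥ ∨ L = ⊤

end Representations

/-- The objects that act: the Thompson groups `F`, `T`, `V` and the Cuntz algebra `O`. -/
inductive Acting : Type
  | F
  | T
  | V
  | O

/-- The elements whose action is recorded: all elements of the group for the Thompson groups, and for
the Cuntz algebra the generators `s_i` (`Sum.inl i`) and their adjoints `s_i*` (`Sum.inr i`). -/
def Acting.Index : Acting → Type
  | F => thompsonF
  | T => thompsonT
  | V => thompsonV
  | O => Bool ⊕ Bool

namespace PModule

variable {H : Type*} [NormedAddCommGroup H] [InnerProductSpace ℂ H] [CompleteSpace H]
variable (m : PModule H)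

/-- The Pythagorean representation of Thompson's group `V`. -/
def repV : thompsonV →* unitary (m.Lim →L[ℂ] m.Lim) := m.cuntz.onV

/-- The Pythagorean representation of Thompson's group `T`. -/
def repT : thompsonT →* unitary (m.Lim →L[ℂ] m.Lim) :=
  m.repV.comp (Subgroup.inclusion thompsonT_le)

/-- The Pythagorean representation of Thompson's group `F`. -/
def repF : thompsonF →* unitary (m.Lim →L[ℂ] m.Lim) :=
  m.repT.comp (Subgroup.inclusion thompsonF_le)

theorem word_cuntz_cls (t : BTree) : ∀ ξ : t.Leaf → H,
    ∑ v, m.cuntz.word (t.addr v) (m.cls leaf (fun _ => ξ v) : m.PreLim) =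
      ((m.cls t ξ : m.PreLim) : m.Lim) := by
  have hS : ∀ i, m.cuntz.S i = m.graftOp i := m.adjoint_tau
  induction t with
  | leaf =>
      intro ξ
      rw [sum_leaf]
      change ((m.cls leaf (fun _ => ξ Leaf.root) : m.PreLim) : m.Lim) = _
      congr 2
      funext v
      cases v
      rfl
  | node l r hl hr =>
      intro ξ
      rw [sum_node]
      simp only [addr, CuntzRep.word, ContinuousLinearMap.comp_apply]
      rw [← map_sum, ← map_sum, hl (fun v => ξ (Leaf.inl v)), hr (fun v => ξ (Leaf.inr v)), hS, hS,
        graftOp_coe, graftOp_coe, ← UniformSpace.Completion.coe_add]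
      congr 1
      change m.cls (node l leaf) _ + m.cls (node leaf r) _ = _
      rw [← m.cls_connect (t := node l leaf) (s := node l r) ⟨le_refl' _, leaf_le _⟩,
        ← m.cls_connect (t := node leaf r) (s := node l r) ⟨leaf_le _, le_refl' _⟩, ← cls_add]
      congr 1
      funext v
      cases v with
      | inl v =>
          rw [Pi.add_apply, connect_inl, connect_inl, connect_self, connect_leaf]
          exact (congrArg _ (map_zero _)).trans (add_zero _)
      | inr v =>
          rw [Pi.add_apply, connect_inr, connect_inr, connect_self, connect_leaf]
          exact (congrArg (· + _) (map_zero _)).trans (zero_add _)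

/-- The group acts on decorated trees by the formula `g • [s, ξ] = [t, ξ ∘ κ⁻¹]`. -/
theorem repV_cls (g : thompsonV) {s t : BTree} {κ : s.Leaf ≃ t.Leaf} (h : Represents g s t κ)
    (ξ : s.Leaf → H) :
    (m.repV g : m.Lim →L[ℂ] m.Lim) (m.cls s ξ : m.PreLim) =
      (m.cls t (fun v => ξ (κ.symm v)) : m.PreLim) := by
  rw [← word_cuntz_cls, ← word_cuntz_cls, map_sum, ← κ.sum_comp]
  refine Finset.sum_congr rfl fun v _ => ?_
  rw [Equiv.symm_apply_apply]
  exact m.cuntz.opV_word g (h v) _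

/-- The Pythagorean representations of `F`, `T`, `V` and of the Cuntz algebra. -/
def rep : (X : Acting) → X.Index → m.Lim →L[ℂ] m.Lim
  | Acting.F => fun g => (m.repF g : m.Lim →L[ℂ] m.Lim)
  | Acting.T => fun g => (m.repT g : m.Lim →L[ℂ] m.Lim)
  | Acting.V => fun g => (m.repV g : m.Lim →L[ℂ] m.Lim)
  | Acting.O => fun i => match i with
      | Sum.inl i => m.cuntz.S i
      | Sum.inr i => (m.cuntz.S i).adjoint

/-! ### Notions for P-modules -/

section Morphisms

variable {H' : Type*} [NormedAddCommGroup H'] [InnerProductSpace ℂ H'] [CompleteSpace H']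

/-- Morphisms of P-modules; the adjoints of the operators need not be intertwined. -/
def IsMorphism (m : PModule H) (m' : PModule H') (θ : H →L[ℂ] H') : Prop :=
  θ ∘L m.A = m'.A ∘L θ ∧ θ ∘L m.B = m'.B ∘L θ

/-- Unitary equivalence of P-modules. -/
def Equivalent (m : PModule H) (m' : PModule H') : Prop :=
  ∃ U : H ≃ₗᵢ[ℂ] H', (∀ x, U (m.A x) = m'.A (U x)) ∧ ∀ x, U (m.B x) = m'.B (U x)

end Morphisms

/-- A P-module is diffuse if `p_n ⋯ p_1 ξ → 0` for every vector `ξ` and every infinite word `p` in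
the two operators. -/
def IsDiffuse : Prop :=
  ∀ (p : ℕ → Bool) (ξ : H), Filter.Tendsto
    (fun n : ℕ => m.word (List.ofFn fun k : Fin n => p k) ξ) Filter.atTop (nhds 0)

/-- A sub-module: a closed subspace invariant under both operators. -/
structure SubModule where
  /-- the underlying subspace -/
  carrier : Submodule ℂ H
  isClosed : IsClosed (carrier : Set H)
  A_mem : ∀ x ∈ carrier, m.A x ∈ carrier
  B_mem : ∀ x ∈ carrier, m.B x ∈ carrier

variable {m}

instance (K : m.SubModule) : CompleteSpace K.carrier := K.isClosed.completeSpace_coe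

/-- A sub-module, as a P-module for the restricted operators. -/
def SubModule.toPModule (K : m.SubModule) : PModule K.carrier where
  A := (m.A ∘L K.carrier.subtypeL).codRestrict K.carrier fun x => K.A_mem x x.2
  B := (m.B ∘L K.carrier.subtypeL).codRestrict K.carrier fun x => K.B_mem x x.2
  pythagoras := by
    ext1 x
    refine ext_inner_left ℂ fun y => ?_
    have h := m.inner_op y x
    simp only [add_apply, ContinuousLinearMap.comp_apply, inner_add_right,
      ContinuousLinearMap.adjoint_inner_right]
    exact h

/-- A sub-module is complete if its orthogonal complement contains no nonzero sub-module. -/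
def SubModule.IsComplete (K : m.SubModule) : Prop :=
  ∀ L : m.SubModule, L.carrier ≤ K.carrierᗮ → L.carrier = ⊥

variable (m)

/-- A P-module is indecomposable if it does not contain the orthogonal direct sum of two nonzero
sub-modules. -/
def IsIndecomposable : Prop :=
  ¬ ∃ K L : m.SubModule, K.carrier ≠ ⊥ ∧ L.carrier ≠ ⊥ ∧ K.carrier ⟂ L.carrier

/-- The intersection of all complete sub-modules. -/
def smallestComplete : m.SubModule where
  carrier := sInf {L | ∃ K : m.SubModule, K.IsComplete ∧ K.carrier = L}
  isClosed := by
    rw [Submodule.coe_sInf]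
    refine isClosed_biInter ?_
    rintro L ⟨K, _, rfl⟩
    exact K.isClosed
  A_mem x hx := by
    rw [Submodule.mem_sInf] at hx ⊢
    rintro L ⟨K, hK, rfl⟩
    exact K.A_mem x (hx _ ⟨K, hK, rfl⟩)
  B_mem x hx := by
    rw [Submodule.mem_sInf] at hx ⊢
    rintro L ⟨K, hK, rfl⟩
    exact K.B_mem x (hx _ ⟨K, hK, rfl⟩)

end PModule

end

end Pythagorean

/-!
The theorem has an operator-algebraic half and a geometric half.

**From Thompson's group `F` to the Cuntz algebra.** Write `S_0`, `S_1` for the isometries of a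
representation of the Cuntz algebra. Diffuseness gives `(S_i*) ^ n → 0` strongly for `i = 0, 1`
(`PModule.IsDiffuse.isDiffuseAtEnds`). Hence the generator `rotation` of `F`, which replaces the
prefixes `00`, `01`, `1` by `0`, `10`, `11`, fixes no nonzero vector, and the vectors fixed by its copy
that acts below a word `w` form the kernel of `S_w*`
(`CuntzRep.adjoint_word_eq_zero_of_rotationOp`). So the adjoint of an intertwiner `Θ` of `F` maps
these kernels to each other, and `Θ` preserves the ranges of the `S_w`. The copies of `rotation` also
show that the compression `S_w* Θ S_w` is the same operator `T` for all words `w` with both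
letters. Then `Θ S_w = S_w T` for these words, so `T` commutes with `S_0` and `S_1`, and `Θ = T` since
the ranges of these `S_w` span a dense subspace (`CuntzRep.IntertwinesF.map_S`). Applied to orthogonal
projections, this identifies the closed invariant subspaces as well. All four cases of the theorem
reduce in this way to the Cuntz algebra.

**Complete sub-modules.** A complete sub-module `K` of the Hilbert space spans a dense subspace under
the `S_w`. If `K` had trivial intersection with a nonzero sub-module `L`, and one of them had finite
dimension, there would be a positive angle between them, and the identity
`⟪x, y⟫ = ∑ i, ⟪S_i* x, S_i* y⟫` would spread the bound on inner products from `K` to this dense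
subspace, which is absurd. So `K` meets `L` whenever one of them has finite dimension
(`PModule.SubModule.IsComplete.inf_ne_bot`), and the rest follows from this fact. Intersections of
complete sub-modules are complete if one has finite dimension, so there is a smallest complete
sub-module. A nontrivial invariant subspace and its orthogonal complement both meet the original
P-module, which is the criterion for irreducibility. An intertwiner maps the smallest complete
sub-module to the other one, because the part that it does map there is complete. Finally, the inner
products `⟪S_v x, S_w y⟫` for `x`, `y` in a complete sub-module depend only on its structure as a
P-module, so a unitary equivalence of P-modules extends to the Hilbert spaces
(`PModule.exists_unitary_of_equivalent`).
-/

namespace Pythagorean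

noncomputable section

open BTree

/-! ### Elements of Thompson's group `F` -/

theorem cantor_cases {P : Cantor → Prop} (h : ∀ i x, P (Stream'.cons i x)) (x : Cantor) : P x := by
  rw [← Stream'.eta x]
  exact h _ _

theorem lexLT_cons {i j : Bool} {x y : Cantor} :
    LexLT (Stream'.cons i x) (Stream'.cons j y) ↔
      (i = false ∧ j = true) ∨ (i = j ∧ LexLT x y) := by
  constructor
  · rintro ⟨n, h, h₀, h₁⟩
    cases n with
    | zero => exact Or.inl ⟨h₀, h₁⟩
    | succ n => exact Or.inr ⟨h 0 n.succ_pos, n, fun k hk => h (k + 1) (by omega), h₀, h₁⟩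
  · rintro (⟨rfl, rfl⟩ | ⟨rfl, n, h, h₀, h₁⟩)
    · exact ⟨0, fun k hk => absurd hk k.not_lt_zero, rfl, rfl⟩
    · refine ⟨n + 1, fun k hk => ?_, h₀, h₁⟩
      cases k with
      | zero => rfl
      | succ k => exact h k (by omega)

/-- The first standard generator of Thompson's group `F`, as a transformation of the Cantor space:
the prefixes `00`, `01`, `1` are replaced by `0`, `10`, `11`. -/
def rotation : Equiv.Perm Cantor where
  toFun x := match x.head, x.tail.head with
    | true, _ => Stream'.cons true x
    | false, true => Stream'.cons true (Stream'.cons false x.tail.tail)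
    | false, false => x.tail
  invFun x := match x.head, x.tail.head with
    | false, _ => Stream'.cons false x
    | true, false => Stream'.cons false (Stream'.cons true x.tail.tail)
    | true, true => x.tail
  left_inv x := by
    induction x using cantor_cases with
    | _ i x =>
    induction x using cantor_cases with
    | _ j x => cases i <;> cases j <;> rfl
  right_inv x := by
    induction x using cantor_cases with
    | _ i x =>
    induction x using cantor_cases with
    | _ j x => cases i <;> cases j <;> rfl

theorem rotation_one (x : Cantor) : rotation ([true] ++ₛ x) = [true, true] ++ₛ x := rfl

theorem rotation_zero_one (x : Cantor) :
    rotation ([false, true] ++ₛ x) = [true, false] ++ₛ x := rfl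

theorem rotation_zero_zero (x : Cantor) : rotation ([false, false] ++ₛ x) = [false] ++ₛ x := rfl

theorem rotation_mem_thompsonV : rotation ∈ thompsonV := by
  refine ⟨node (node leaf leaf) leaf, node leaf (node leaf leaf),
    { toFun := fun v => match v with
        | Leaf.inl (Leaf.inl _) => Leaf.inl Leaf.root
        | Leaf.inl (Leaf.inr _) => Leaf.inr (Leaf.inl Leaf.root)
        | Leaf.inr _ => Leaf.inr (Leaf.inr Leaf.root)
      invFun := fun v => match v with
        | Leaf.inl _ => Leaf.inl (Leaf.inl Leaf.root)
        | Leaf.inr (Leaf.inl _) => Leaf.inl (Leaf.inr Leaf.root)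
        | Leaf.inr (Leaf.inr _) => Leaf.inr Leaf.root
      left_inv := fun
        | Leaf.inl (Leaf.inl Leaf.root) => rfl
        | Leaf.inl (Leaf.inr Leaf.root) => rfl
        | Leaf.inr Leaf.root => rfl
      right_inv := fun
        | Leaf.inl Leaf.root => rfl
        | Leaf.inr (Leaf.inl Leaf.root) => rfl
        | Leaf.inr (Leaf.inr Leaf.root) => rfl }, fun
    | Leaf.inl (Leaf.inl Leaf.root), _ => rfl
    | Leaf.inl (Leaf.inr Leaf.root), _ => rfl
    | Leaf.inr Leaf.root, _ => rfl⟩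

theorem rotation_mem_thompsonF : rotation ∈ thompsonF := by
  refine ⟨rotation_mem_thompsonV, fun x y => ?_⟩
  induction x using cantor_cases with
  | _ i x =>
  induction x using cantor_cases with
  | _ i' x =>
  induction y using cantor_cases with
  | _ j y =>
  induction y using cantor_cases with
  | _ j' y =>
  cases i <;> cases i' <;> cases j <;> cases j' <;>
    simp [rotation, lexLT_cons, Stream'.tail_cons]

/-- The transformation that acts as `g` after the first digit `i`, and trivially on the sequences
that start with the other digit. -/
def localize (i : Bool) (g : Equiv.Perm Cantor) : Equiv.Perm Cantor where
  toFun x := if x.head = i then Stream'.cons i (g x.tail) else x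
  invFun x := if x.head = i then Stream'.cons i (g⁻¹ x.tail) else x
  left_inv x := by
    induction x using cantor_cases with
    | _ j x => by_cases h : j = i <;> simp [h]
  right_inv x := by
    induction x using cantor_cases with
    | _ j x => by_cases h : j = i <;> simp [h]

theorem localize_cons (i j : Bool) (g : Equiv.Perm Cantor) (x : Cantor) :
    localize i g (Stream'.cons j x) = if j = i then Stream'.cons i (g x) else Stream'.cons j x := rfl

theorem localize_mem_thompsonV (i : Bool) {g : Equiv.Perm Cantor} (hg : g ∈ thompsonV) :
    localize i g ∈ thompsonV := by
  obtain ⟨s, t, κ, h⟩ := hg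
  cases i
  · refine ⟨node s leaf, node t leaf,
      (nodeEquiv s leaf).symm.trans ((κ.sumCongr (Equiv.refl _)).trans (nodeEquiv t leaf)), fun
      | Leaf.inl v, x => congrArg (Stream'.cons false) (h v x)
      | Leaf.inr Leaf.root, x => rfl⟩
  · refine ⟨node leaf s, node leaf t,
      (nodeEquiv leaf s).symm.trans
        (((Equiv.refl _).sumCongr κ).trans (nodeEquiv leaf t)), fun
      | Leaf.inl Leaf.root, x => rfl
      | Leaf.inr v, x => congrArg (Stream'.cons true) (h v x)⟩

theorem localize_mem_thompsonF (i : Bool) {g : Equiv.Perm Cantor} (hg : g ∈ thompsonF) :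
    localize i g ∈ thompsonF := by
  refine ⟨localize_mem_thompsonV i hg.1, fun x y => ?_⟩
  have h := hg.2
  induction x using cantor_cases with
  | _ j x =>
  induction y using cantor_cases with
  | _ k y => cases i <;> cases j <;> cases k <;> simp [localize_cons, lexLT_cons, h]

/-- The copy of `rotation` that acts on the sequences with a given prefix. -/
def rotationAt : List Bool → Equiv.Perm Cantor
  | [] => rotation
  | i :: w => localize i (rotationAt w)

theorem rotationAt_mem_thompsonF : ∀ w, rotationAt w ∈ thompsonF
  | [] => rotation_mem_thompsonF
  | i :: w => localize_mem_thompsonF i (rotationAt_mem_thompsonF w)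

theorem rotationAt_append {μ ν : List Bool} (h : ∀ x, rotation (μ ++ₛ x) = ν ++ₛ x) (x : Cantor) :
    ∀ w, rotationAt w ((w ++ μ) ++ₛ x) = (w ++ ν) ++ₛ x
  | [] => h x
  | i :: w => by
      change (if i = i then _ else _) = _
      rw [if_pos rfl]
      exact congrArg (Stream'.cons i) (rotationAt_append h x w)

/-! ### Operators of a representation of the Cuntz algebra -/

namespace CuntzRep

variable {K : Type*} [NormedAddCommGroup K] [InnerProductSpace ℂ K] [CompleteSpace K]
variable (c : CuntzRep K)

/-- The representation is diffuse along the two constant words: `(S_i*) ^ n → 0` strongly. -/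
def IsDiffuseAtEnds : Prop :=
  ∀ i x, Filter.Tendsto (fun n => (c.word (List.replicate n i)).adjoint x) Filter.atTop (nhds 0)

theorem adjoint_word_cons (i : Bool) (w : List Bool) (x : K) :
    (c.word (i :: w)).adjoint x = (c.word w).adjoint ((c.S i).adjoint x) := by
  simp [word, ContinuousLinearMap.adjoint_comp]

theorem adjoint_word_self : ∀ (w : List Bool) (x : K), (c.word w).adjoint (c.word w x) = x
  | [], x => c.adjoint_id_apply x
  | i :: w, x => by
      rw [adjoint_word_cons]
      change (c.word w).adjoint ((c.S i).adjoint (c.S i (c.word w x))) = x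
      rw [adjoint_S_S, adjoint_word_self w]

theorem norm_adjoint_word_le (w : List Bool) (x : K) : ‖(c.word w).adjoint x‖ ≤ ‖x‖ := by
  have h : ‖c.word w ((c.word w).adjoint x)‖ = ‖(c.word w).adjoint x‖ := by
    rw [← sq_eq_sq₀ (norm_nonneg _) (norm_nonneg _),
      ContinuousLinearMap.apply_norm_sq_eq_inner_adjoint_right, ContinuousLinearMap.comp_apply,
      adjoint_word_self, inner_self_eq_norm_sq]
  have h₂ := ContinuousLinearMap.apply_norm_sq_eq_inner_adjoint_right (c.word w).adjoint x
  rw [ContinuousLinearMap.adjoint_adjoint, ContinuousLinearMap.comp_apply] at h₂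
  have h₃ := (re_inner_le_norm (𝕜 := ℂ) x (c.word w ((c.word w).adjoint x)))
  rw [h, ← h₂, sq] at h₃
  by_contra! hlt
  nlinarith [norm_nonneg x]

theorem adjoint_S_S_of_ne {i j : Bool} (h : i ≠ j) (x : K) : (c.S i).adjoint (c.S j x) = 0 := by
  obtain rfl : j = !i := by cases i <;> cases j <;> simp_all
  exact c.adjoint_S_S_not i x

theorem sum_S_not (i : Bool) (x : K) :
    c.S i ((c.S i).adjoint x) + c.S (!i) ((c.S (!i)).adjoint x) = x := by
  cases i
  · exact c.sum_S x
  · rw [add_comm]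
    exact c.sum_S x

/-- A continuous linear map is zero if it vanishes on the ranges of all `S_i ^ n S_j`, `j ≠ i`, as
the part `S_i ^ n (S_i*) ^ n x` of a vector `x` that they miss tends to `0`. -/
theorem eq_zero_of_comb {E : Type*} [NormedAddCommGroup E] [NormedSpace ℂ E] (i : Bool)
    (hc : ∀ x, Filter.Tendsto (fun n => (c.word (List.replicate n i)).adjoint x)
      Filter.atTop (nhds 0)) (T : K →L[ℂ] E)
    (hT : ∀ n x, T (c.word (List.replicate n i ++ [!i]) x) = 0) : T = 0 := by
  have key : ∀ n x, T (c.word (List.replicate n i)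
      ((c.word (List.replicate n i)).adjoint x)) = T x := by
    intro n x
    induction n with
    | zero => exact congrArg T (c.adjoint_id_apply x)
    | succ n ih =>
        have h := c.sum_S_not i ((c.word (List.replicate n i)).adjoint x)
        have h' : c.word (List.replicate (n + 1) i) = c.word (List.replicate n i) ∘L c.S i := by
          ext y
          rw [List.replicate_succ', word_append]
          rfl
        rw [← ih, ← h, h', ContinuousLinearMap.adjoint_comp, map_add, map_add]
        have := hT n ((c.S (!i)).adjoint ((c.word (List.replicate n i)).adjoint x))
        rw [word_append] at this
        change T (c.word _ (c.S (!i) _)) = 0 at this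
        rw [this, add_zero]
        rfl
  ext x
  have hb : ∀ n, ‖T x‖ ≤ ‖T‖ * ‖(c.word (List.replicate n i)).adjoint x‖ := fun n => by
    rw [← key n x]
    refine (T.le_opNorm _).trans (mul_le_mul_of_nonneg_left ?_ (norm_nonneg _))
    rw [← sq_le_sq₀ (norm_nonneg _) (norm_nonneg _),
      ContinuousLinearMap.apply_norm_sq_eq_inner_adjoint_right,
      ContinuousLinearMap.comp_apply, adjoint_word_self, inner_self_eq_norm_sq]
  have hl : Filter.Tendsto (fun n => ‖T‖ * ‖(c.word (List.replicate n i)).adjoint x‖)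
      Filter.atTop (nhds 0) := by
    simpa using ((hc x).norm).const_mul ‖T‖
  exact norm_le_zero_iff.1 (ge_of_tendsto' hl hb)

theorem opV_localize_S (i : Bool) (g : thompsonV) (x : K) :
    c.opV ⟨localize i g, localize_mem_thompsonV i g.2⟩ (c.S i x) = c.S i (c.opV g x) := by
  obtain ⟨s, t, κ, h⟩ := g.2
  refine congrArg (fun T : K →L[ℂ] K => T x) (c.eq_of_leaves s
    (T := c.opV ⟨localize i g, localize_mem_thompsonV i g.2⟩ ∘L c.S i) (T' := c.S i ∘L c.opV g)
    fun v y => ?_)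
  rw [ContinuousLinearMap.comp_apply, ContinuousLinearMap.comp_apply, c.opV_word g (h v)]
  refine c.opV_word _ (μ := i :: s.addr v) (ν := i :: t.addr (κ v)) (fun x => ?_) y
  change (if i = i then _ else _) = _
  rw [if_pos rfl]
  exact congrArg (Stream'.cons i) (h v x)

theorem opV_localize_S_not (i : Bool) (g : thompsonV) (x : K) :
    c.opV ⟨localize i g, localize_mem_thompsonV i g.2⟩ (c.S (!i) x) = c.S (!i) x := by
  refine c.opV_word _ (μ := [!i]) (ν := [!i]) (fun x => ?_) x
  change (if (!i) = i then _ else _) = _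
  rw [if_neg (by simp)]

/-- The operator of `rotationAt w`. -/
abbrev rotationOp (w : List Bool) : K →L[ℂ] K :=
  c.opV ⟨rotationAt w, (rotationAt_mem_thompsonF w).1⟩

theorem rotationOp_cons_S (i : Bool) (w : List Bool) (x : K) :
    c.rotationOp (i :: w) (c.S i x) = c.S i (c.rotationOp w x) :=
  c.opV_localize_S i ⟨rotationAt w, (rotationAt_mem_thompsonF w).1⟩ x

theorem rotationOp_cons_S_not (i : Bool) (w : List Bool) (x : K) :
    c.rotationOp (i :: w) (c.S (!i) x) = c.S (!i) x :=
  c.opV_localize_S_not i ⟨rotationAt w, (rotationAt_mem_thompsonF w).1⟩ x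

theorem rotationOp_of_adjoint_word_eq_zero : ∀ (w : List Bool) (x : K),
    (c.word w).adjoint x = 0 → c.rotationOp w x = x
  | [], x, h => by
      rw [adjoint_id_apply] at h
      rw [h, map_zero]
  | i :: w, x, h => by
      rw [adjoint_word_cons] at h
      nth_rw 1 [← c.sum_S_not i x]
      rw [map_add, rotationOp_cons_S, rotationOp_cons_S_not,
        rotationOp_of_adjoint_word_eq_zero w _ h, c.sum_S_not]

theorem inner_opV (g : thompsonV) (x y : K) : ⟪c.opV g x, c.opV g y⟫_ℂ = ⟪x, y⟫_ℂ := by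
  rw [← ContinuousLinearMap.adjoint_inner_right, adjoint_opV, ← mul_apply_eq_comp, ← opV_mul,
    inv_mul_cancel, opV_one]
  rfl

/-- If `U (S_μ x) = S_ν x` for all `x`, then `S_ν* U = S_μ*`. -/
theorem adjoint_word_opV {g : thompsonV} {μ ν : List Bool}
    (h : ∀ x : Cantor, (g : Equiv.Perm Cantor) (μ ++ₛ x) = ν ++ₛ x) (x : K) :
    (c.word ν).adjoint (c.opV g x) = (c.word μ).adjoint x := by
  refine ext_inner_right ℂ fun y => ?_
  rw [ContinuousLinearMap.adjoint_inner_left, ContinuousLinearMap.adjoint_inner_left,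
    ← c.opV_word g h, inner_opV]

/-- If `(S_i*) ^ n → 0` strongly, then `0` is the only vector fixed by the generator of `F`: a fixed
vector `x` satisfies `S_1* S_1* x = S_1* x` and `S_0* S_0* x = S_0* x`. Hence the vectors fixed by its
copy at `w` are those in the kernel of `S_w*`. -/
theorem adjoint_word_eq_zero_of_rotationOp
    (hc : c.IsDiffuseAtEnds) : ∀ (w : List Bool) (x : K),
    c.rotationOp w x = x → (c.word w).adjoint x = 0
  | [], x, h => by
      have key : ∀ i (y : K), (c.S i).adjoint ((c.S i).adjoint y) = (c.S i).adjoint y →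
          (c.S i).adjoint y = 0 := by
        intro i y hy
        refine tendsto_nhds_unique (tendsto_const_nhds.congr fun n => ?_) (hc i ((c.S i).adjoint y))
        induction n with
        | zero => exact (c.adjoint_id_apply _).symm
        | succ n ih => rw [List.replicate_succ, adjoint_word_cons, hy, ← ih]
      have h₁ := c.adjoint_word_opV (g := ⟨rotationAt [], (rotationAt_mem_thompsonF []).1⟩)
        rotation_one x
      have h₀ := c.adjoint_word_opV (g := ⟨rotationAt [], (rotationAt_mem_thompsonF []).1⟩)
        rotation_zero_zero x
      rw [h] at h₀ h₁
      simp only [adjoint_word_cons, adjoint_id_apply] at h₀ h₁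
      rw [adjoint_id_apply, ← c.sum_S x, key false x h₀.symm, key true x h₁]
      simp
  | i :: w, x, h => by
      rw [adjoint_word_cons]
      refine adjoint_word_eq_zero_of_rotationOp hc w _ ?_
      nth_rw 1 [← c.sum_S_not i x] at h
      rw [map_add, rotationOp_cons_S, rotationOp_cons_S_not] at h
      have := congrArg (c.S i).adjoint h
      rwa [map_add, adjoint_S_S, adjoint_S_S_not, add_zero] at this

end CuntzRep

/-! ### Intertwiners of `F` are intertwiners of the Cuntz algebra -/

namespace CuntzRep

variable {K K' : Type*} [NormedAddCommGroup K] [InnerProductSpace ℂ K] [CompleteSpace K]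
variable [NormedAddCommGroup K'] [InnerProductSpace ℂ K'] [CompleteSpace K']

/-- `Θ` intertwines the restrictions to Thompson's group `F` of two representations of the Cuntz
algebra. -/
def IntertwinesF (c : CuntzRep K) (c' : CuntzRep K') (Θ : K →L[ℂ] K') : Prop :=
  ∀ (g : thompsonV), (g : Equiv.Perm Cantor) ∈ thompsonF → ∀ x, Θ (c.opV g x) = c'.opV g (Θ x)

variable {c : CuntzRep K} {c' : CuntzRep K'} {Θ : K →L[ℂ] K'}

theorem IntertwinesF.adjoint (h : IntertwinesF c c' Θ) : IntertwinesF c' c Θ.adjoint := by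
  intro g hg x
  refine ext_inner_right ℂ fun y => ?_
  have h' := h g⁻¹ (inv_mem hg) y
  rw [← adjoint_opV, ← adjoint_opV] at h'
  rw [ContinuousLinearMap.adjoint_inner_left, ← ContinuousLinearMap.adjoint_inner_right, ← h',
    ← ContinuousLinearMap.adjoint_inner_left, ContinuousLinearMap.adjoint_inner_right]

/-- An intertwiner maps the kernel of `S_w*` to the kernel of `S_w*`, as these are the vectors fixed
by the copy of `rotation` at `w`. -/
theorem IntertwinesF.adjoint_word_eq_zero (h : IntertwinesF c c' Θ) (hc' : c'.IsDiffuseAtEnds)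
    (w : List Bool) {x : K} (hx : (c.word w).adjoint x = 0) : (c'.word w).adjoint (Θ x) = 0 := by
  refine c'.adjoint_word_eq_zero_of_rotationOp hc' w _ ?_
  rw [← h _ (rotationAt_mem_thompsonF w), c.rotationOp_of_adjoint_word_eq_zero w x hx]

/-- An intertwiner maps the range of `S_w` to the range of `S_w`: its adjoint preserves the orthogonal
complements of these ranges, the kernels of `S_w*`. -/
theorem IntertwinesF.map_word (h : IntertwinesF c c' Θ) (hc : c.IsDiffuseAtEnds)
    (w : List Bool) (x : K) :
    c'.word w ((c'.word w).adjoint (Θ (c.word w x))) = Θ (c.word w x) := by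
  set y := Θ (c.word w x) with hy
  set z := y - c'.word w ((c'.word w).adjoint y) with hz
  have hz₀ : (c'.word w).adjoint z = 0 := by
    rw [hz, map_sub, adjoint_word_self, sub_self]
  have h₁ : ⟪z, y⟫_ℂ = 0 := by
    rw [hy, ← ContinuousLinearMap.adjoint_inner_left, ← ContinuousLinearMap.adjoint_inner_left,
      h.adjoint.adjoint_word_eq_zero hc w hz₀, inner_zero_left]
  have h₂ : ⟪z, c'.word w ((c'.word w).adjoint y)⟫_ℂ = 0 := by
    rw [← ContinuousLinearMap.adjoint_inner_left, hz₀, inner_zero_left]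
  have h₃ : ⟪z, z⟫_ℂ = 0 := by
    nth_rw 2 [hz]
    rw [inner_sub_right, h₁, h₂, sub_zero]
  exact (sub_eq_zero.1 (inner_self_eq_zero.1 h₃)).symm

/-- The operator between the ranges of `S_w` that is induced by `Θ`, moved to the whole spaces. -/
def compress (c : CuntzRep K) (c' : CuntzRep K') (Θ : K →L[ℂ] K') (w : List Bool) : K →L[ℂ] K' :=
  (c'.word w).adjoint ∘L Θ ∘L c.word w

/-- The compressions of an intertwiner at two words agree if an element of `F` replaces one of these
prefixes by the other. -/
theorem IntertwinesF.compress_eq (h : IntertwinesF c c' Θ) {g : Equiv.Perm Cantor}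
    (hg : g ∈ thompsonF) {μ ν : List Bool} (hμν : ∀ x : Cantor, g (μ ++ₛ x) = ν ++ₛ x) :
    compress c c' Θ μ = compress c c' Θ ν := by
  ext x
  change (c'.word μ).adjoint (Θ (c.word μ x)) = (c'.word ν).adjoint (Θ (c.word ν x))
  rw [← c.opV_word ⟨g, hg.1⟩ hμν x, h _ hg, c'.adjoint_word_opV hμν]

theorem IntertwinesF.compress_append (h : IntertwinesF c c' Θ) {μ ν : List Bool}
    (hμν : ∀ x : Cantor, rotation (μ ++ₛ x) = ν ++ₛ x) (u w : List Bool) :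
    compress c c' Θ (u ++ (μ ++ w)) = compress c c' Θ (u ++ (ν ++ w)) :=
  h.compress_eq (rotationAt_mem_thompsonF u) fun x => rotationAt_append (fun x => by
    rw [Stream'.append_append_stream, hμν, Stream'.append_append_stream]) x u

/-- The compression of an intertwiner at a word does not depend on the order of the letters, since the
copies of `rotation` in `F` replace `01` by `10` at any place of a prefix. -/
theorem IntertwinesF.compress_perm (h : IntertwinesF c c' Θ) {μ ν : List Bool} (hp : μ.Perm ν) :
    ∀ u, compress c c' Θ (u ++ μ) = compress c c' Θ (u ++ ν) := by
  induction hp with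
  | nil => exact fun _ => rfl
  | cons i _ ih =>
      intro u
      simpa using ih (u ++ [i])
  | swap i j w =>
      intro u
      cases i <;> cases j
      · rfl
      · exact (h.compress_append rotation_zero_one u w).symm
      · exact h.compress_append rotation_zero_one u w
      · rfl
  | trans _ _ ih ih' => exact fun u => (ih u).trans (ih' u)

/-- The first letter of a word can be dropped if it occurs again: bring the next occurrence to the
second place and apply `rotation`. -/
theorem IntertwinesF.compress_cons (h : IntertwinesF c c' Θ) {i : Bool} {w : List Bool}
    (hi : i ∈ w) : compress c c' Θ (i :: w) = compress c c' Θ w := by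
  have hp := List.perm_cons_erase hi
  have h₁ := h.compress_perm (hp.cons i) []
  have h₂ := h.compress_perm hp []
  rw [List.nil_append, List.nil_append] at h₁ h₂
  rw [h₁, h₂]
  cases i
  · exact h.compress_append rotation_zero_zero [] _
  · exact (h.compress_append rotation_one [] _).symm

/-- The compressions of an intertwiner at all words with both letters agree, as each of them agrees
with the compression at the word followed by `01`. -/
theorem IntertwinesF.compress_of_mem (h : IntertwinesF c c' Θ) {w : List Bool}
    (h₀ : false ∈ w) (h₁ : true ∈ w) :
    compress c c' Θ w = compress c c' Θ [false, true] := by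
  have key : ∀ u, compress c c' Θ (u ++ [false, true]) = compress c c' Θ [false, true] := by
    intro u
    induction u with
    | nil => rfl
    | cons i u ih => rw [List.cons_append, h.compress_cons (by cases i <;> simp), ih]
  have hw : ∀ i ∈ w, ∀ u, compress c c' Θ (w ++ i :: u) = compress c c' Θ (w ++ u) := by
    intro i hi u
    have := h.compress_perm (List.perm_middle (a := i) (l₁ := w) (l₂ := u)) []
    rw [List.nil_append, List.nil_append] at this
    rw [this, h.compress_cons (by simp [hi])]
  rw [← key w, hw _ h₀, hw _ h₁, List.append_nil]

/-- An intertwiner `Θ` of `F` is an intertwiner of the Cuntz algebra, if both representations are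
diffuse along the constant words: the compressions of `Θ` at all words with both letters are the same
operator `T`, which commutes with the generators because `Θ` preserves the ranges of the `S_w`; and
`Θ = T` because the ranges for these words span a dense subspace. -/
theorem IntertwinesF.map_S (h : IntertwinesF c c' Θ) (hc : c.IsDiffuseAtEnds) (i : Bool) (x : K) :
    Θ (c.S i x) = c'.S i (Θ x) := by
  set T := compress c c' Θ [false, true] with hT
  -- Every word with both letters can replace `01`.
  have h₁ : ∀ w, false ∈ w → true ∈ w → ∀ x, Θ (c.word w x) = c'.word w (T x) := by
    intro w h₀ h₁ x
    rw [hT, ← h.compress_of_mem h₀ h₁]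
    exact (h.map_word hc w x).symm
  have h₂ : ∀ i x, T (c.S i x) = c'.S i (T x) := by
    intro i x
    have := h₁ ([false, true] ++ [i]) (by simp) (by simp) x
    rw [word_append, word_append, h₁ _ (by simp) (by simp)] at this
    have := congrArg (c'.word [false, true]).adjoint this
    rwa [adjoint_word_self, adjoint_word_self] at this
  have h₃ : ∀ w x, T (c.word w x) = c'.word w (T x) := by
    intro w
    induction w with
    | nil => exact fun _ => rfl
    | cons j w ih => exact fun x => (h₂ j _).trans (congrArg (c'.S j) (ih x))
  -- On the range of `S_j`, it is enough to test the `S_j S_j ^ n S_k`, `k ≠ j`, words with both letters.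
  have h₄ : ∀ j, (Θ - T) ∘L c.S j = 0 := by
    intro j
    refine c.eq_zero_of_comb j (hc j) _ fun n x => ?_
    change Θ (c.word (j :: (List.replicate n j ++ [!j])) x) - T (c.word (j :: _) x) = 0
    rw [h₃, h₁ _ (by cases j <;> simp) (by cases j <;> simp), sub_self]
  have h₅ : Θ = T := by
    ext x
    have e : ∀ j, Θ (c.S j ((c.S j).adjoint x)) = T (c.S j ((c.S j).adjoint x)) := fun j =>
      sub_eq_zero.1 (congrArg (fun R : K →L[ℂ] K' => R ((c.S j).adjoint x)) (h₄ j))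
    rw [← c.sum_S x, map_add, map_add, e, e]
  rw [h₅, h₂]

theorem map_word_of_map_S (h : ∀ i x, Θ (c.S i x) = c'.S i (Θ x)) :
    ∀ (w : List Bool) (x : K), Θ (c.word w x) = c'.word w (Θ x)
  | [], _ => rfl
  | i :: w, x => (h i _).trans (congrArg (c'.S i) (map_word_of_map_S h w x))

theorem map_adjoint_S_of_map_S (h : ∀ i x, Θ (c.S i x) = c'.S i (Θ x)) (i : Bool) (x : K) :
    Θ ((c.S i).adjoint x) = (c'.S i).adjoint (Θ x) := by
  conv_rhs => rw [← c.sum_S_not i x]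
  rw [map_add, h, h, map_add, adjoint_S_S, adjoint_S_S_not, add_zero]

theorem map_opV_of_map_S (h : ∀ i x, Θ (c.S i x) = c'.S i (Θ x)) (g : thompsonV) (x : K) :
    Θ (c.opV g x) = c'.opV g (Θ x) := by
  obtain ⟨s, t, κ, hg⟩ := g.2
  rw [← c.sum_word s x]
  simp only [map_sum]
  refine Finset.sum_congr rfl fun v _ => ?_
  rw [c.opV_word g (hg v), map_word_of_map_S h, map_word_of_map_S h, c'.opV_word g (hg v)]

theorem opV_mem (c : CuntzRep K) {L : Submodule ℂ K}
    (hS : ∀ i, ∀ x ∈ L, c.S i x ∈ L) (hS' : ∀ i, ∀ x ∈ L, (c.S i).adjoint x ∈ L)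
    (g : thompsonV) {x : K} (hx : x ∈ L) : c.opV g x ∈ L := by
  have h₁ : ∀ (w : List Bool), ∀ x ∈ L, c.word w x ∈ L := by
    intro w
    induction w with
    | nil => exact fun _ h => h
    | cons i w ih => exact fun x h => hS i _ (ih x h)
  have h₂ : ∀ (w : List Bool), ∀ x ∈ L, (c.word w).adjoint x ∈ L := by
    intro w
    induction w with
    | nil => exact fun x h => by rwa [c.adjoint_id_apply]
    | cons i w ih =>
        intro x h
        rw [c.adjoint_word_cons]
        exact ih _ (hS' i x h)
  rw [opV, diagramOp, sum_apply]
  exact L.sum_mem fun v _ => h₁ _ _ (h₂ _ _ hx)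

end CuntzRep

/-! ### The representation of the Cuntz algebra of a P-module -/

namespace PModule

variable {H : Type*} [NormedAddCommGroup H] [InnerProductSpace ℂ H] [CompleteSpace H]
variable (m : PModule H)

theorem op_lim (i : Bool) : m.lim.op i = m.tau i := by
  cases i <;> rfl

theorem adjoint_cuntz_S (i : Bool) : (m.cuntz.S i).adjoint = m.lim.op i := by
  rw [op_lim]
  exact ContinuousLinearMap.adjoint_adjoint _

theorem adjoint_cuntz_word : ∀ w : List Bool, (m.cuntz.word w).adjoint = m.lim.word w
  | [] => by
      ext x
      exact m.cuntz.adjoint_id_apply x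
  | i :: w => by
      ext x
      rw [CuntzRep.adjoint_word_cons, adjoint_cuntz_S, adjoint_cuntz_word w]
      rfl

theorem lim_op_cuntz_S (i j : Bool) (x : m.Lim) :
    m.lim.op i (m.cuntz.S j x) = if i = j then x else 0 := by
  rw [← adjoint_cuntz_S]
  split_ifs with h
  · rw [h, CuntzRep.adjoint_S_S]
  · rw [CuntzRep.adjoint_S_S_of_ne _ h]

theorem embed_apply (x : H) : m.embed x = (m.cls leaf (fun _ => x) : m.PreLim) := rfl

theorem norm_embed (x : H) : ‖m.embed x‖ = ‖x‖ := by
  rw [embed_apply, UniformSpace.Completion.norm_coe, ← sq_eq_sq₀ (norm_nonneg _) (norm_nonneg _),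
    ← inner_self_eq_norm_sq (𝕜 := ℂ), inner_cls, sum_leaf, inner_self_eq_norm_sq]

theorem lim_word_embed : ∀ (w : List Bool) (x : H), m.lim.word w (m.embed x) = m.embed (m.word w x)
  | [], _ => rfl
  | i :: w, x => by
      change m.lim.word w (m.lim.op i (m.embed x)) = m.embed (m.word w (m.op i x))
      rw [← lim_word_embed w, op_lim, embed_apply, tau_coe, snip_cls, snipTree_leaf, embed_apply]

/-- For a decorated tree, sufficiently many equal digits lead to the decoration of one leaf, where the
diffuseness of the P-module applies; such vectors are dense. -/
theorem IsDiffuse.isDiffuseAtEnds {m : PModule H} (h : m.IsDiffuse) :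
    m.cuntz.IsDiffuseAtEnds := by
  intro i x
  have h₁ : ∀ (t : BTree) (ξ : t.Leaf → H), Filter.Tendsto
      (fun n => m.lim.word (List.replicate n i) (m.cls t ξ : m.PreLim)) Filter.atTop (nhds 0) := by
    intro t
    induction t with
    | leaf =>
        intro ξ
        have h₃ : Continuous m.embed :=
          AddMonoidHomClass.continuous_of_bound m.embed 1 fun x => by rw [norm_embed, one_mul]
        have h₄ := (h₃.tendsto 0).comp (h (fun _ => i) (ξ Leaf.root))
        rw [map_zero] at h₄
        refine h₄.congr fun n => ?_
        rw [Function.comp_apply, List.ofFn_const, ← lim_word_embed, embed_apply]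
        congr 3
        funext v
        cases v
        rfl
    | node l r hl hr =>
        intro ξ
        refine (Filter.tendsto_add_atTop_iff_nat 1).1 ?_
        cases i
        · refine (hl (fun v => ξ (Leaf.inl v))).congr fun n => ?_
          change _ = m.lim.word _ (m.tau false _)
          rw [tau_coe, snip_cls, snipTree_false]
        · refine (hr (fun v => ξ (Leaf.inr v))).congr fun n => ?_
          change _ = m.lim.word _ (m.tau true _)
          rw [tau_coe, snip_cls, snipTree_true]
  rw [Metric.tendsto_atTop]
  intro ε hε
  obtain ⟨y, hy⟩ := UniformSpace.Completion.denseRange_coe.exists_dist_lt x (half_pos hε)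
  obtain ⟨t, ξ, rfl⟩ := m.exists_cls y
  obtain ⟨N, hN⟩ := Metric.tendsto_atTop.1 (h₁ t ξ) _ (half_pos hε)
  refine ⟨N, fun n hn => ?_⟩
  have h₂ := hN n hn
  rw [← adjoint_cuntz_word, dist_zero_right] at h₂
  have h₃ := m.cuntz.norm_adjoint_word_le (List.replicate n i) (x - (m.cls t ξ : m.PreLim))
  rw [map_sub] at h₃
  rw [dist_eq_norm] at hy
  rw [dist_zero_right]
  have h₄ := norm_sub_norm_le ((m.cuntz.word (List.replicate n i)).adjoint x)
    ((m.cuntz.word (List.replicate n i)).adjoint (m.cls t ξ : m.PreLim))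
  linarith

end PModule

/-! ### Complete sub-modules -/

/-- A finite-dimensional subspace and a complete subspace with trivial intersection have a positive
angle. -/
theorem exists_norm_inner_le {E : Type*} [NormedAddCommGroup E] [InnerProductSpace ℂ E]
    (M N : Submodule ℂ E) [FiniteDimensional ℂ M] [CompleteSpace N] (h : M ⊓ N = ⊥) :
    ∃ c < (1 : ℝ), 0 ≤ c ∧ ∀ x ∈ M, ∀ y ∈ N, ‖⟪x, y⟫_ℂ‖ ≤ c * (‖x‖ * ‖y‖) := by
  have hc : IsCompact (Metric.sphere (0 : M) 1) := isCompact_sphere _ _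
  obtain ⟨c, hc₁, hc₀, hc⟩ : ∃ c < (1 : ℝ), 0 ≤ c ∧
      ∀ x ∈ Metric.sphere (0 : M) 1, ‖N.starProjection (x : E)‖ ≤ c := by
    rcases (Metric.sphere (0 : M) 1).eq_empty_or_nonempty with he | hne
    · exact ⟨0, one_pos, le_rfl, fun x hx => by simp [he] at hx⟩
    · obtain ⟨x, hx, hmax⟩ := hc.exists_isMaxOn hne
        (f := fun x : M => ‖N.starProjection (x : E)‖) (by fun_prop)
      refine ⟨_, lt_of_le_of_ne ?_ fun he => ?_, norm_nonneg _, hmax⟩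
      · have := N.norm_starProjection_apply_le (x : E)
        rwa [← Submodule.coe_norm, mem_sphere_zero_iff_norm.1 hx] at this
      -- A vector that the projection does not shorten lies in `N`.
      · have hxN : (x : E) ∈ N := by
          rw [N.mem_iff_norm_starProjection, he, ← Submodule.coe_norm, mem_sphere_zero_iff_norm.1 hx]
        have : (x : E) ∈ M ⊓ N := ⟨x.2, hxN⟩
        rw [h, Submodule.mem_bot, Submodule.coe_eq_zero] at this
        rw [this] at hx
        simp at hx
  refine ⟨c, hc₁, hc₀, fun x hx y hy => ?_⟩
  have h₁ : ‖N.starProjection x‖ ≤ c * ‖x‖ := by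
    rcases eq_or_ne x 0 with rfl | hx₀
    · simp
    · have hx₁ : ‖x‖ ≠ 0 := norm_ne_zero_iff.2 hx₀
      have := hc ((‖x‖⁻¹ : ℂ) • ⟨x, hx⟩) (by
        rw [mem_sphere_zero_iff_norm, norm_smul]
        simp [hx₁])
      simp only [Submodule.coe_smul, map_smul, norm_smul, norm_inv, Complex.norm_real,
        norm_norm] at this
      rwa [inv_mul_le_iff₀ (norm_pos_iff.2 hx₀), mul_comm] at this
  calc ‖⟪x, y⟫_ℂ‖ = ‖⟪N.starProjection x, y⟫_ℂ‖ := by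
        rw [N.inner_starProjection_left_eq_right, N.starProjection_eq_self_iff.2 hy]
    _ ≤ ‖N.starProjection x‖ * ‖y‖ := norm_inner_le_norm _ _
    _ ≤ c * ‖x‖ * ‖y‖ := by gcongr
    _ = c * (‖x‖ * ‖y‖) := mul_assoc _ _ _

namespace PModule

variable {H : Type*} [NormedAddCommGroup H] [InnerProductSpace ℂ H] [CompleteSpace H]

theorem norm_sq_op (m : PModule H) (x : H) : ‖m.op false x‖ ^ 2 + ‖m.op true x‖ ^ 2 = ‖x‖ ^ 2 := by
  have h := congrArg Complex.re (m.inner_op x x)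
  simpa [inner_self_eq_norm_sq_to_K, ← Complex.ofReal_pow] using h

namespace SubModule

variable {m : PModule H}

theorem op_mem (K : m.SubModule) (i : Bool) {x : H} (hx : x ∈ K.carrier) : m.op i x ∈ K.carrier := by
  cases i
  · exact K.A_mem x hx
  · exact K.B_mem x hx

theorem word_mem (K : m.SubModule) : ∀ (w : List Bool) {x : H}, x ∈ K.carrier →
    m.word w x ∈ K.carrier
  | [], _, hx => hx
  | i :: w, _, hx => K.word_mem w (K.op_mem i hx)

/-- The intersection of two sub-modules. -/
def inf (K L : m.SubModule) : m.SubModule where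
  carrier := K.carrier ⊓ L.carrier
  isClosed := K.isClosed.inter L.isClosed
  A_mem x hx := ⟨K.A_mem x hx.1, L.A_mem x hx.2⟩
  B_mem x hx := ⟨K.B_mem x hx.1, L.B_mem x hx.2⟩

/-- The largest sub-module in the orthogonal complement of a sub-module. -/
def perp (K : m.SubModule) : m.SubModule where
  carrier := ⨅ w : List Bool, K.carrierᗮ.comap (m.word w).toLinearMap
  isClosed := by
    rw [Submodule.coe_iInf]
    exact isClosed_iInter fun w => K.carrier.isClosed_orthogonal.preimage (m.word w).continuous
  A_mem x hx := (Submodule.mem_iInf _).2 fun w => (Submodule.mem_iInf _).1 hx (false :: w)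
  B_mem x hx := (Submodule.mem_iInf _).2 fun w => (Submodule.mem_iInf _).1 hx (true :: w)

theorem mem_perp {K : m.SubModule} {x : H} :
    x ∈ K.perp.carrier ↔ ∀ w, m.word w x ∈ K.carrierᗮ := Submodule.mem_iInf _

theorem perp_le (K : m.SubModule) : K.perp.carrier ≤ K.carrierᗮ := fun _ hx => mem_perp.1 hx []

theorem le_perp {K L : m.SubModule} (h : L.carrier ≤ K.carrierᗮ) : L.carrier ≤ K.perp.carrier :=
  fun _ hx => mem_perp.2 fun w => h (L.word_mem w hx)

theorem isComplete_iff {K : m.SubModule} : K.IsComplete ↔ K.perp.carrier = ⊥ :=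
  ⟨fun h => h _ K.perp_le, fun h _ hL => le_bot_iff.1 (h ▸ le_perp hL)⟩

end SubModule

variable {m : PModule H}

/-- The linear map `(x_w) ↦ ∑ w, S_w x_w` on the finitely supported families in a subspace: its range
is the subspace spanned under the generators of the Cuntz algebra. -/
def spread (m : PModule H) (M : Submodule ℂ m.Lim) : (List Bool →₀ M) →ₗ[ℂ] m.Lim :=
  Finsupp.lsum ℂ fun w => (m.cuntz.word w).toLinearMap ∘ₗ M.subtype

theorem spread_single (M : Submodule ℂ m.Lim) (w : List Bool) (x : M) :
    m.spread M (Finsupp.single w x) = m.cuntz.word w x := by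
  simp [spread]

theorem SubModule.denseRange_spread {K : m.lim.SubModule} (hK : K.IsComplete) :
    DenseRange (m.spread K.carrier) := by
  rw [DenseRange, ← LinearMap.coe_range, Submodule.dense_iff_topologicalClosure_eq_top,
    Submodule.topologicalClosure_eq_top_iff, ← le_bot_iff, ← SubModule.isComplete_iff.1 hK]
  intro x hx
  refine SubModule.mem_perp.2 fun w y hy => ?_
  rw [← adjoint_cuntz_word, ContinuousLinearMap.adjoint_inner_right]
  exact hx _ ⟨Finsupp.single w ⟨y, hy⟩, spread_single _ _ _⟩

theorem SubModule.lim_word_cuntz_word_mem (K : m.lim.SubModule) {x : m.Lim} (hx : x ∈ K.carrier) :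
    ∀ v w : List Bool, v.length ≤ w.length → m.lim.word w (m.cuntz.word v x) ∈ K.carrier
  | [], w, _ => K.word_mem w hx
  | i :: v, j :: w, h => by
      change m.lim.word w (m.lim.op j (m.cuntz.S i (m.cuntz.word v x))) ∈ K.carrier
      rw [lim_op_cuntz_S]
      split_ifs
      · exact lim_word_cuntz_word_mem K hx v w (by simpa using h)
      · rw [map_zero]
        exact K.carrier.zero_mem

theorem SubModule.exists_lim_word_spread_mem (K : m.lim.SubModule) (f : List Bool →₀ K.carrier) :
    ∃ n, ∀ w : List Bool, n ≤ w.length → m.lim.word w (m.spread K.carrier f) ∈ K.carrier := by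
  induction f using Finsupp.induction_linear with
  | zero => exact ⟨0, fun w _ => by simp⟩
  | add f g hf hg =>
      obtain ⟨n, hn⟩ := hf
      obtain ⟨n', hn'⟩ := hg
      refine ⟨max n n', fun w hw => ?_⟩
      rw [map_add, map_add]
      exact K.carrier.add_mem (hn w (le_of_max_le_left hw)) (hn' w (le_of_max_le_right hw))
  | single v x =>
      refine ⟨v.length, fun w hw => ?_⟩
      rw [spread_single]
      exact K.lim_word_cuntz_word_mem x.2 v w hw

/-- An angle between two sub-modules persists for the vectors whose images under all long words are
in the second one. -/
theorem SubModule.norm_inner_le (K L : m.lim.SubModule) {c : ℝ} (hc₀ : 0 ≤ c)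
    (hc : ∀ x ∈ L.carrier, ∀ y ∈ K.carrier, ‖⟪x, y⟫_ℂ‖ ≤ c * (‖x‖ * ‖y‖)) (n : ℕ) :
    ∀ x ∈ L.carrier, ∀ y : m.Lim, (∀ w : List Bool, n ≤ w.length → m.lim.word w y ∈ K.carrier) →
      ‖⟪x, y⟫_ℂ‖ ≤ c * (‖x‖ * ‖y‖) := by
  induction n with
  | zero => exact fun x hx y hy => hc x hx y (hy [] le_rfl)
  | succ n ih =>
      intro x hx y hy
      have h : ∀ i, ‖⟪m.lim.op i x, m.lim.op i y⟫_ℂ‖ ≤ c * (‖m.lim.op i x‖ * ‖m.lim.op i y‖) :=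
        fun i => ih _ (L.op_mem i hx) _ fun w hw => hy (i :: w) (by simpa using hw)
      have hx₂ := m.lim.norm_sq_op x
      have hy₂ := m.lim.norm_sq_op y
      set a := ‖m.lim.op false x‖
      set b := ‖m.lim.op true x‖
      set a' := ‖m.lim.op false y‖
      set b' := ‖m.lim.op true y‖
      have hcs : a * a' + b * b' ≤ ‖x‖ * ‖y‖ := by
        refine abs_le_of_sq_le_sq' ?_ (by positivity) |>.2
        rw [mul_pow, ← hx₂, ← hy₂]
        nlinarith [sq_nonneg (a * b' - b * a')]
      calc ‖⟪x, y⟫_ℂ‖ ≤ c * (a * a') + c * (b * b') := by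
            rw [← m.lim.inner_op x y]
            exact (norm_add_le _ _).trans (add_le_add (h false) (h true))
        _ = c * (a * a' + b * b') := by ring
        _ ≤ c * (‖x‖ * ‖y‖) := by gcongr

/-- A complete sub-module meets every nonzero sub-module, if one of the two has finite dimension:
otherwise there is an angle between them, hence between the second one and the dense subspace spanned
by the first one under the generators of the Cuntz algebra. -/
theorem SubModule.IsComplete.inf_ne_bot {K : m.lim.SubModule} (hK : K.IsComplete)
    (L : m.lim.SubModule) (hL : L.carrier ≠ ⊥)
    (hfin : FiniteDimensional ℂ K.carrier ∨ FiniteDimensional ℂ L.carrier) :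
    K.carrier ⊓ L.carrier ≠ ⊥ := by
  intro h
  obtain ⟨c, hc₁, hc₀, hc⟩ : ∃ c < (1 : ℝ), 0 ≤ c ∧
      ∀ x ∈ L.carrier, ∀ y ∈ K.carrier, ‖⟪x, y⟫_ℂ‖ ≤ c * (‖x‖ * ‖y‖) := by
    rcases hfin with hfin | hfin
    · obtain ⟨c, hc₁, hc₀, hc⟩ := exists_norm_inner_le K.carrier L.carrier h
      refine ⟨c, hc₁, hc₀, fun x hx y hy => ?_⟩
      rw [norm_inner_symm, mul_comm ‖x‖]
      exact hc y hy x hx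
    · exact exists_norm_inner_le L.carrier K.carrier (inf_comm K.carrier L.carrier ▸ h)
  refine hL ((Submodule.eq_bot_iff _).2 fun x hx => ?_)
  have key : ∀ y, ‖⟪x, y⟫_ℂ‖ ≤ c * (‖x‖ * ‖y‖) := fun y => by
    refine (SubModule.denseRange_spread hK).induction_on y
      (isClosed_le (by fun_prop) (by fun_prop)) fun f => ?_
    obtain ⟨n, hn⟩ := K.exists_lim_word_spread_mem f
    exact K.norm_inner_le L hc₀ hc n x hx _ hn
  have h₁ := key x
  rw [inner_self_eq_norm_sq_to_K, norm_pow, RCLike.norm_ofReal, abs_norm] at h₁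
  by_contra hx₀
  have : 0 < ‖x‖ := norm_pos_iff.2 hx₀
  nlinarith [mul_pos this this]

/-- A sub-module orthogonal to `K ∩ K'` would meet `K` in a finite-dimensional sub-module, and that one
would meet `K'`. -/
theorem SubModule.IsComplete.inf {K K' : m.lim.SubModule} (hK : K.IsComplete)
    (hK' : K'.IsComplete) (hfin : FiniteDimensional ℂ K.carrier) : (K.inf K').IsComplete := by
  intro L hL
  by_contra hL₀
  have h₁ := hK.inf_ne_bot L hL₀ (Or.inl hfin)
  have h₂ := hK'.inf_ne_bot (K.inf L) h₁ (Or.inr (Submodule.finiteDimensional_of_le inf_le_left))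
  obtain ⟨x, hx, hx₀⟩ := Submodule.exists_mem_ne_zero_of_ne_bot h₂
  have : x ∈ (K.inf K').carrier := ⟨hx.2.1, hx.1⟩
  exact hx₀ (inner_self_eq_zero.1 (hL hx.2.2 x this))

/-- The copy of a finite-dimensional P-module in its Hilbert space. -/
def embedSubModule (m : PModule H) [FiniteDimensional ℂ H] : m.lim.SubModule where
  carrier := LinearMap.range m.embed
  isClosed := Submodule.closed_of_finiteDimensional _
  A_mem := by
    rintro _ ⟨x, rfl⟩
    exact ⟨_, (m.lim_word_embed [false] x).symm⟩
  B_mem := by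
    rintro _ ⟨x, rfl⟩
    exact ⟨_, (m.lim_word_embed [true] x).symm⟩

/-- The copy of the P-module is complete because every decorated tree is a sum of images `S_w x` of
vectors in it. -/
theorem embedSubModule_isComplete (m : PModule H) [FiniteDimensional ℂ H] :
    m.embedSubModule.IsComplete := by
  rw [SubModule.isComplete_iff, Submodule.eq_bot_iff]
  intro x hx
  refine UniformSpace.Completion.denseRange_coe.eq_zero_of_inner_right ℂ
    (f := fun y : m.PreLim => (y : m.Lim)) fun y => ?_
  obtain ⟨t, ξ, rfl⟩ := m.exists_cls y
  rw [← word_cuntz_cls, sum_inner]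
  refine Finset.sum_eq_zero fun v _ => ?_
  rw [← ContinuousLinearMap.adjoint_inner_right, adjoint_cuntz_word]
  exact SubModule.mem_perp.1 hx _ _ ⟨ξ v, rfl⟩

theorem smallestComplete_le {m : PModule H} {K : m.SubModule} (hK : K.IsComplete) :
    m.smallestComplete.carrier ≤ K.carrier := sInf_le ⟨K, hK, rfl⟩

/-- Among the complete sub-modules of finite dimension one of least dimension is the smallest complete
sub-module, as it cannot be made smaller by intersections. -/
theorem smallestComplete_isComplete (m : PModule H) [FiniteDimensional ℂ H] :
    m.lim.smallestComplete.IsComplete := by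
  have hfin : FiniteDimensional ℂ m.embedSubModule.carrier :=
    inferInstanceAs (FiniteDimensional ℂ (LinearMap.range m.embed))
  obtain ⟨K, ⟨hK, hKfin⟩, hmin⟩ := (InvImage.wf
    (fun K : m.lim.SubModule => Module.finrank ℂ K.carrier) Nat.lt_wfRel.wf).has_min
    {K | K.IsComplete ∧ FiniteDimensional ℂ K.carrier} ⟨_, m.embedSubModule_isComplete, hfin⟩
  have h : m.lim.smallestComplete.carrier = K.carrier := by
    refine le_antisymm (smallestComplete_le hK) (le_sInf ?_)
    rintro _ ⟨K', hK', rfl⟩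
    have h₁ : K.carrier ⊓ K'.carrier = K.carrier :=
      Submodule.eq_of_le_of_finrank_le inf_le_left (not_lt.1 (hmin (K.inf K')
        ⟨hK.inf hK' hKfin, Submodule.finiteDimensional_of_le inf_le_left⟩))
    exact inf_eq_left.1 h₁
  intro L hL
  exact hK L (h ▸ hL)

theorem smallestComplete_le_range_embed (m : PModule H) [FiniteDimensional ℂ H] :
    m.lim.smallestComplete.carrier ≤ LinearMap.range m.embed :=
  smallestComplete_le m.embedSubModule_isComplete

theorem finiteDimensional_smallestComplete (m : PModule H) [FiniteDimensional ℂ H] :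
    FiniteDimensional ℂ m.lim.smallestComplete.carrier :=
  Submodule.finiteDimensional_of_le m.smallestComplete_le_range_embed

end PModule

namespace PModule

variable {H : Type*} [NormedAddCommGroup H] [InnerProductSpace ℂ H] [CompleteSpace H]
variable {H' : Type*} [NormedAddCommGroup H'] [InnerProductSpace ℂ H'] [CompleteSpace H']
variable {m : PModule H} {m' : PModule H'}

/-! ### Independence of the acting group or algebra -/

/-- For all four acting objects, the intertwiners are those of the generators of the Cuntz algebra. -/
theorem IsDiffuse.intertwines_rep_iff (hm : m.IsDiffuse) (X : Acting)
    (Θ : m.Lim →L[ℂ] m'.Lim) : Intertwines (m.rep X) (m'.rep X) Θ ↔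
      ∀ i x, Θ (m.cuntz.S i x) = m'.cuntz.S i (Θ x) := by
  constructor
  · intro h
    have hF : X ≠ Acting.O → CuntzRep.IntertwinesF m.cuntz m'.cuntz Θ := by
      intro hX g hg x
      cases X with
      | F => exact congrArg (fun T : m.Lim →L[ℂ] m'.Lim => T x) (h ⟨g, hg⟩)
      | T => exact congrArg (fun T : m.Lim →L[ℂ] m'.Lim => T x) (h ⟨g, thompsonF_le hg⟩)
      | V => exact congrArg (fun T : m.Lim →L[ℂ] m'.Lim => T x) (h g)
      | O => exact absurd rfl hX
    cases X with
    | O => exact fun i x => congrArg (fun T : m.Lim →L[ℂ] m'.Lim => T x) (h (Sum.inl i))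
    | F | T | V => exact fun i x => (hF (by simp)).map_S hm.isDiffuseAtEnds i x
  · intro h g
    ext x
    cases X with
    | F | T | V => exact CuntzRep.map_opV_of_map_S h _ x
    | O =>
        rcases g with i | i
        · exact h i x
        · exact CuntzRep.map_adjoint_S_of_map_S h i x

theorem IsDiffuse.unitarilyEquivalent_rep_iff (hm : m.IsDiffuse)
    (X : Acting) : UnitarilyEquivalent (m.rep X) (m'.rep X) ↔
      ∃ U : m.Lim ≃ₗᵢ[ℂ] m'.Lim, ∀ i x, U (m.cuntz.S i x) = m'.cuntz.S i (U x) := by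
  refine exists_congr fun U => ?_
  have h := hm.intertwines_rep_iff X (U.toContinuousLinearEquiv : m.Lim →L[ℂ] m'.Lim)
  simpa [Intertwines, ContinuousLinearMap.ext_iff] using h

/-- The closed subspaces invariant under `F` are those invariant under the Cuntz algebra: the
orthogonal projection on such a subspace is an intertwiner. -/
theorem IsDiffuse.forall_rep_mem_iff (hm : m.IsDiffuse) (X : Acting) {L : Submodule ℂ m.Lim}
    (hL : IsClosed (L : Set m.Lim)) : (∀ i, ∀ x ∈ L, m.rep X i x ∈ L) ↔
      (∀ i, ∀ x ∈ L, m.cuntz.S i x ∈ L) ∧ ∀ i, ∀ x ∈ L, m.lim.op i x ∈ L := by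
  have : CompleteSpace L := hL.completeSpace_coe
  constructor
  · intro h
    by_cases hX : X = Acting.O
    · subst hX
      refine ⟨fun i => h (Sum.inl i), fun i => ?_⟩
      rw [← adjoint_cuntz_S]
      exact h (Sum.inr i)
    · have hF : ∀ g : thompsonV, (g : Equiv.Perm Cantor) ∈ thompsonF → ∀ x ∈ L,
          m.cuntz.opV g x ∈ L := by
        intro g hg
        cases X with
        | F => exact h ⟨g, hg⟩
        | T => exact h ⟨g, thompsonF_le hg⟩
        | V => exact h g
        | O => exact absurd rfl hX
      have hP : CuntzRep.IntertwinesF m.cuntz m.cuntz L.starProjection := by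
        intro g hg x
        refine Submodule.eq_starProjection_of_mem_of_inner_eq_zero
          (hF g hg _ (L.starProjection_apply_mem x)) fun y hy => ?_
        rw [← map_sub, ← ContinuousLinearMap.adjoint_inner_right, CuntzRep.adjoint_opV]
        exact L.starProjection_inner_eq_zero x _ (hF g⁻¹ (inv_mem hg) y hy)
      have hS := hP.map_S hm.isDiffuseAtEnds
      have hS' := CuntzRep.map_adjoint_S_of_map_S hS
      refine ⟨fun i x hx => ?_, fun i x hx => ?_⟩
      · rw [← Submodule.starProjection_eq_self_iff, hS, Submodule.starProjection_eq_self_iff.2 hx]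
      · rw [← adjoint_cuntz_S, ← Submodule.starProjection_eq_self_iff, hS',
          Submodule.starProjection_eq_self_iff.2 hx]
  · rintro ⟨hS, hS'⟩ g x hx
    simp only [← adjoint_cuntz_S] at hS'
    cases X with
    | F | T | V => exact m.cuntz.opV_mem hS hS' _ hx
    | O =>
        rcases g with i | i
        · exact hS i x hx
        · exact hS' i x hx

/-! ### Irreducibility -/

theorem inner_embed (x y : H) : ⟪m.embed x, m.embed y⟫_ℂ = ⟪x, y⟫_ℂ := by
  rw [embed_apply, embed_apply, UniformSpace.Completion.inner_coe, inner_cls, sum_leaf]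

theorem embed_injective (m : PModule H) : Function.Injective m.embed :=
  (injective_iff_map_eq_zero _).2 fun x hx => norm_eq_zero.1 (by rw [← m.norm_embed, hx, norm_zero])

theorem SubModule.cuntz_S_mem_perp (K : m.lim.SubModule) (i : Bool) {x : m.Lim}
    (hx : x ∈ K.perp.carrier) : m.cuntz.S i x ∈ K.perp.carrier := by
  refine SubModule.mem_perp.2 fun w => ?_
  cases w with
  | nil =>
      intro y hy
      change ⟪y, m.cuntz.S i x⟫_ℂ = 0
      rw [← ContinuousLinearMap.adjoint_inner_left, adjoint_cuntz_S]
      exact K.perp_le hx _ (K.op_mem i hy)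
  | cons j w =>
      change m.lim.word w (m.lim.op j (m.cuntz.S i x)) ∈ _
      rw [lim_op_cuntz_S]
      split_ifs
      · exact SubModule.mem_perp.1 hx w
      · rw [map_zero]
        exact Submodule.zero_mem _

/-- A nontrivial closed invariant subspace and its orthogonal complement both meet the copy of the
P-module; conversely, orthogonal sub-modules span orthogonal invariant subspaces. -/
theorem IsDiffuse.isIrreducible_rep_iff [FiniteDimensional ℂ H] [Nontrivial H] (hm : m.IsDiffuse)
    (X : Acting) : IsIrreducible (m.rep X) ↔ m.IsIndecomposable := by
  constructor
  · rintro ⟨-, h⟩ ⟨K, L, hK, hL, hKL⟩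
    let K' : m.lim.SubModule :=
      { carrier := K.carrier.map m.embed
        isClosed := Submodule.closed_of_finiteDimensional _
        A_mem := by
          rintro _ ⟨x, hx, rfl⟩
          exact ⟨_, K.A_mem x hx, (m.lim_word_embed [false] x).symm⟩
        B_mem := by
          rintro _ ⟨x, hx, rfl⟩
          exact ⟨_, K.B_mem x hx, (m.lim_word_embed [true] x).symm⟩ }
    rcases h K'.perp.carrier K'.perp.isClosed ((hm.forall_rep_mem_iff X K'.perp.isClosed).2
      ⟨fun i x hx => K'.cuntz_S_mem_perp i hx, fun i x hx => K'.perp.op_mem i hx⟩) with h | h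
    · obtain ⟨x, hx, hx₀⟩ := Submodule.exists_mem_ne_zero_of_ne_bot hL
      have hx' : m.embed x ∈ K'.perp.carrier := by
        refine SubModule.mem_perp.2 fun w => ?_
        rintro _ ⟨y, hy, rfl⟩
        rw [lim_word_embed, inner_embed]
        exact hKL.inner_eq hy (L.word_mem w hx)
      rw [h, Submodule.mem_bot] at hx'
      exact hx₀ (m.embed_injective (hx'.trans (map_zero _).symm))
    · obtain ⟨x, hx, hx₀⟩ := Submodule.exists_mem_ne_zero_of_ne_bot hK
      have hx' : m.embed x ∈ K'.perp.carrier := h ▸ Submodule.mem_top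
      have := K'.perp_le hx' (m.embed x) ⟨x, hx, rfl⟩
      rw [inner_embed] at this
      exact hx₀ (inner_self_eq_zero.1 this)
  · intro h
    refine ⟨m.embed_injective.nontrivial, fun L hL hLX => ?_⟩
    obtain ⟨hS, hS'⟩ := (hm.forall_rep_mem_iff X hL).1 hLX
    have : CompleteSpace L := hL.completeSpace_coe
    by_contra! hne
    let K₁ : m.lim.SubModule := ⟨L, hL, hS' false, hS' true⟩
    have hperp : ∀ i, ∀ x ∈ Lᗮ, m.lim.op i x ∈ Lᗮ := by
      intro i x hx y hy
      rw [← adjoint_cuntz_S, ContinuousLinearMap.adjoint_inner_right]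
      exact hx _ (hS i y hy)
    let K₂ : m.lim.SubModule := ⟨Lᗮ, L.isClosed_orthogonal, hperp false, hperp true⟩
    have hfin : FiniteDimensional ℂ m.embedSubModule.carrier :=
      inferInstanceAs (FiniteDimensional ℂ (LinearMap.range m.embed))
    have hpull : ∀ K : m.lim.SubModule, K.carrier ≠ ⊥ →
        ∃ N : m.SubModule, N.carrier ≠ ⊥ ∧ ∀ x ∈ N.carrier, m.embed x ∈ K.carrier := by
      intro K hK
      refine ⟨⟨K.carrier.comap m.embed, Submodule.closed_of_finiteDimensional _, fun x hx => ?_,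
        fun x hx => ?_⟩, ?_, fun x hx => hx⟩
      · change m.embed (m.word [false] x) ∈ K.carrier
        rw [← lim_word_embed]
        exact K.A_mem _ hx
      · change m.embed (m.word [true] x) ∈ K.carrier
        rw [← lim_word_embed]
        exact K.B_mem _ hx
      · obtain ⟨_, ⟨⟨x, rfl⟩, hx⟩, hx₀⟩ := Submodule.exists_mem_ne_zero_of_ne_bot
          (m.embedSubModule_isComplete.inf_ne_bot K hK (Or.inl hfin))
        refine (Submodule.ne_bot_iff _).2 ⟨x, hx, ?_⟩
        rintro rfl
        exact hx₀ (map_zero _)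
    obtain ⟨N₁, h₁, hN₁⟩ := hpull K₁ hne.1
    obtain ⟨N₂, h₂, hN₂⟩ := hpull K₂ fun he => hne.2 (Submodule.orthogonal_eq_bot_iff.1 he)
    refine h ⟨N₁, N₂, h₁, h₂, Submodule.isOrtho_iff_inner_eq.2 fun x hx y hy => ?_⟩
    rw [← m.inner_embed]
    exact hN₂ y hy _ (hN₁ x hx)

/-! ### Intertwiners and the smallest complete sub-modules -/

theorem map_lim_op_of_map_cuntz_S {Θ : m.Lim →L[ℂ] m'.Lim}
    (h : ∀ i x, Θ (m.cuntz.S i x) = m'.cuntz.S i (Θ x)) (i : Bool) (x : m.Lim) :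
    Θ (m.lim.op i x) = m'.lim.op i (Θ x) := by
  rw [← adjoint_cuntz_S, ← adjoint_cuntz_S]
  exact CuntzRep.map_adjoint_S_of_map_S h i x

/-- The vectors of the smallest complete sub-module that an intertwiner maps to the smallest complete
sub-module form a complete sub-module, hence are all vectors of the first one. A sub-module orthogonal
to them would meet the smallest complete sub-module of the source in a sub-module on which the
intertwiner is injective, and whose image would meet that of the target. -/
theorem map_smallestComplete_mem [FiniteDimensional ℂ H] [FiniteDimensional ℂ H']
    {Θ : m.Lim →L[ℂ] m'.Lim} (h : ∀ i x, Θ (m.cuntz.S i x) = m'.cuntz.S i (Θ x)) {x : m.Lim}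
    (hx : x ∈ m.lim.smallestComplete.carrier) : Θ x ∈ m'.lim.smallestComplete.carrier := by
  have hop := map_lim_op_of_map_cuntz_S h
  have hfin := m.finiteDimensional_smallestComplete
  let M : m.lim.SubModule :=
    { carrier := m.lim.smallestComplete.carrier ⊓
        m'.lim.smallestComplete.carrier.comap Θ.toLinearMap
      isClosed := m.lim.smallestComplete.isClosed.inter
        (m'.lim.smallestComplete.isClosed.preimage Θ.continuous)
      A_mem := fun x hx => ⟨m.lim.smallestComplete.A_mem x hx.1, by
        change Θ (m.lim.op false x) ∈ m'.lim.smallestComplete.carrier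
        rw [hop]
        exact m'.lim.smallestComplete.A_mem _ hx.2⟩
      B_mem := fun x hx => ⟨m.lim.smallestComplete.B_mem x hx.1, by
        change Θ (m.lim.op true x) ∈ m'.lim.smallestComplete.carrier
        rw [hop]
        exact m'.lim.smallestComplete.B_mem _ hx.2⟩ }
  have hM : M.IsComplete := by
    intro L hL
    by_contra hL₀
    have h₀ : ∀ x ∈ L.carrier, x ∈ M.carrier → x = 0 := fun x hx hx' =>
      inner_self_eq_zero.1 (hL hx x hx')
    have h₁ := m.smallestComplete_isComplete.inf_ne_bot L hL₀ (Or.inl hfin)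
    have hfin' : FiniteDimensional ℂ ↥(m.lim.smallestComplete.carrier ⊓ L.carrier) :=
      Submodule.finiteDimensional_of_le inf_le_left
    let N : m'.lim.SubModule :=
      { carrier := (m.lim.smallestComplete.carrier ⊓ L.carrier).map Θ.toLinearMap
        isClosed := Submodule.closed_of_finiteDimensional _
        A_mem := by
          rintro _ ⟨x, hx, rfl⟩
          exact ⟨_, (m.lim.smallestComplete.inf L).A_mem x hx, hop false x⟩
        B_mem := by
          rintro _ ⟨x, hx, rfl⟩
          exact ⟨_, (m.lim.smallestComplete.inf L).B_mem x hx, hop true x⟩ }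
    have hN : N.carrier ≠ ⊥ := by
      intro he
      obtain ⟨x, hx, hx₀⟩ := Submodule.exists_mem_ne_zero_of_ne_bot h₁
      have hx' : Θ x ∈ N.carrier := ⟨x, hx, rfl⟩
      rw [he, Submodule.mem_bot] at hx'
      refine hx₀ (h₀ x hx.2 ⟨hx.1, ?_⟩)
      change Θ x ∈ m'.lim.smallestComplete.carrier
      rw [hx']
      exact Submodule.zero_mem _
    obtain ⟨_, ⟨hy, x, hx, rfl⟩, hy₀⟩ := Submodule.exists_mem_ne_zero_of_ne_bot
      (m'.smallestComplete_isComplete.inf_ne_bot N hN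
        (Or.inl m'.finiteDimensional_smallestComplete))
    refine hy₀ ?_
    rw [h₀ x hx.2 ⟨hx.1, hy⟩, map_zero]
  exact (smallestComplete_le hM hx).2

theorem SubModule.coe_toPModule_op {n : PModule H} (K : n.SubModule) (i : Bool) (x : K.carrier) :
    ((K.toPModule.op i x : K.carrier) : H) = n.op i x := by
  cases i <;> rfl

/-- Inner products between vectors in the ranges of the `S_w` are determined by the P-module. -/
theorem inner_cuntz_word {K : m.lim.SubModule} {K' : m'.lim.SubModule}
    (U : K.carrier ≃ₗᵢ[ℂ] K'.carrier)
    (hU : ∀ i x, U (K.toPModule.op i x) = K'.toPModule.op i (U x)) :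
    ∀ (v w : List Bool) (x y : K.carrier),
      ⟪m'.cuntz.word v (U x : m'.Lim), m'.cuntz.word w (U y : m'.Lim)⟫_ℂ =
        ⟪m.cuntz.word v (x : m.Lim), m.cuntz.word w (y : m.Lim)⟫_ℂ
  | [], [], x, y => U.inner_map_map x y
  | [], j :: w, x, y => by
      have h := inner_cuntz_word U hU [] w (K.toPModule.op j x) y
      rw [hU, SubModule.coe_toPModule_op, SubModule.coe_toPModule_op, ← adjoint_cuntz_S,
        ← adjoint_cuntz_S] at h
      change ⟪(m'.cuntz.S j).adjoint _, _⟫_ℂ = ⟪(m.cuntz.S j).adjoint _, _⟫_ℂ at h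
      rwa [ContinuousLinearMap.adjoint_inner_left, ContinuousLinearMap.adjoint_inner_left] at h
  | i :: v, [], x, y => by
      have h := inner_cuntz_word U hU v [] x (K.toPModule.op i y)
      rw [hU, SubModule.coe_toPModule_op, SubModule.coe_toPModule_op, ← adjoint_cuntz_S,
        ← adjoint_cuntz_S] at h
      change ⟪_, (m'.cuntz.S i).adjoint _⟫_ℂ = ⟪_, (m.cuntz.S i).adjoint _⟫_ℂ at h
      rwa [ContinuousLinearMap.adjoint_inner_right, ContinuousLinearMap.adjoint_inner_right] at h
  | i :: v, j :: w, x, y => by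
      change ⟪m'.cuntz.S i (m'.cuntz.word v _), m'.cuntz.S j (m'.cuntz.word w _)⟫_ℂ =
        ⟪m.cuntz.S i (m.cuntz.word v _), m.cuntz.S j (m.cuntz.word w _)⟫_ℂ
      rw [← ContinuousLinearMap.adjoint_inner_right (m'.cuntz.S i),
        ← ContinuousLinearMap.adjoint_inner_right (m.cuntz.S i), adjoint_cuntz_S, adjoint_cuntz_S,
        lim_op_cuntz_S, lim_op_cuntz_S]
      split_ifs
      · exact inner_cuntz_word U hU v w x y
      · rw [inner_zero_right, inner_zero_right]

/-- A unitary equivalence between complete sub-modules extends to a unitary equivalence of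
representations. -/
theorem exists_unitary_of_equivalent {K : m.lim.SubModule} {K' : m'.lim.SubModule}
    (hK : K.IsComplete) (hK' : K'.IsComplete) (h : K.toPModule.Equivalent K'.toPModule) :
    ∃ U : m.Lim ≃ₗᵢ[ℂ] m'.Lim, ∀ i x, U (m.cuntz.S i x) = m'.cuntz.S i (U x) := by
  obtain ⟨U, hA, hB⟩ := h
  have hU : ∀ i x, U (K.toPModule.op i x) = K'.toPModule.op i (U x) := by
    intro i
    cases i
    · exact hA
    · exact hB
  let e : (List Bool →₀ K.carrier) ≃ₗ[ℂ] (List Bool →₀ K'.carrier) :=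
    Finsupp.mapRange.linearEquiv U.toLinearEquiv
  have he : ∀ w x, e (Finsupp.single w x) = Finsupp.single w (U x) := fun w x =>
    Finsupp.mapRange_single (hf := map_zero U)
  have hinner : ∀ f g : List Bool →₀ K.carrier,
      ⟪m'.spread K'.carrier (e f), m'.spread K'.carrier (e g)⟫_ℂ =
        ⟪m.spread K.carrier f, m.spread K.carrier g⟫_ℂ := by
    intro f g
    induction f using Finsupp.induction_linear with
    | zero => simp
    | add f f' hf hf' => simp only [map_add, inner_add_left, hf, hf']
    | single v x =>
        induction g using Finsupp.induction_linear with
        | zero => simp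
        | add g g' hg hg' => simp only [map_add, inner_add_right, hg, hg']
        | single w y =>
            rw [he, he, spread_single, spread_single, spread_single, spread_single]
            exact inner_cuntz_word U hU v w x y
  have hnorm : ∀ f, ‖m'.spread K'.carrier (e f)‖ = ‖m.spread K.carrier f‖ := fun f => by
    rw [← sq_eq_sq₀ (norm_nonneg _) (norm_nonneg _), ← inner_self_eq_norm_sq (𝕜 := ℂ), hinner,
      inner_self_eq_norm_sq]
  have hd := SubModule.denseRange_spread hK
  have hd' := SubModule.denseRange_spread hK'
  refine ⟨e.extendOfIsometry _ _ hd hd' hnorm, fun i x => ?_⟩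
  refine hd.induction_on x (isClosed_eq (by fun_prop) (by fun_prop)) fun f => ?_
  induction f using Finsupp.induction_linear with
  | zero => simp
  | add f f' hf hf' => simp only [map_add, hf, hf']
  | single w x =>
      have h₁ : m.cuntz.S i (m.spread K.carrier (Finsupp.single w x)) =
          m.spread K.carrier (Finsupp.single (i :: w) x) := by
        rw [spread_single, spread_single]
        rfl
      rw [h₁, LinearEquiv.extendOfIsometry_eq, LinearEquiv.extendOfIsometry_eq, he, he,
        spread_single, spread_single]
      rfl

/-- A unitary equivalence of representations and its inverse preserve the smallest complete
sub-modules. -/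
theorem equivalent_smallestComplete [FiniteDimensional ℂ H] [FiniteDimensional ℂ H']
    (U : m.Lim ≃ₗᵢ[ℂ] m'.Lim) (hU : ∀ i x, U (m.cuntz.S i x) = m'.cuntz.S i (U x)) :
    m.lim.smallestComplete.toPModule.Equivalent m'.lim.smallestComplete.toPModule := by
  have hU' : ∀ i x, U.symm (m'.cuntz.S i x) = m.cuntz.S i (U.symm x) := fun i x => by
    rw [LinearIsometryEquiv.symm_apply_eq, hU, LinearIsometryEquiv.apply_symm_apply]
  have hop := map_lim_op_of_map_cuntz_S
    (Θ := (U.toContinuousLinearEquiv : m.Lim →L[ℂ] m'.Lim)) hU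
  exact ⟨{
    toFun := fun x => ⟨U x, map_smallestComplete_mem
      (Θ := (U.toContinuousLinearEquiv : m.Lim →L[ℂ] m'.Lim)) hU x.2⟩
    invFun := fun x => ⟨U.symm x, map_smallestComplete_mem
      (Θ := (U.symm.toContinuousLinearEquiv : m'.Lim →L[ℂ] m.Lim)) hU' x.2⟩
    map_add' := fun x y => Subtype.ext (map_add U (x : m.Lim) y)
    map_smul' := fun c x => Subtype.ext (map_smul U c (x : m.Lim))
    left_inv := fun x => Subtype.ext (U.symm_apply_apply x)
    right_inv := fun x => Subtype.ext (U.apply_symm_apply x)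
    norm_map' := fun x => U.norm_map x },
    fun x => Subtype.ext (hop false x), fun x => Subtype.ext (hop true x)⟩

end PModule

end

end Pythagorean

theorem theoremB
    {H₁ : Type*} [NormedAddCommGroup H₁] [InnerProductSpace ℂ H₁] [CompleteSpace H₁]
    [FiniteDimensional ℂ H₁]
    {H₂ : Type*} [NormedAddCommGroup H₂] [InnerProductSpace ℂ H₂] [CompleteSpace H₂]
    [FiniteDimensional ℂ H₂]
    (m₁ : Pythagorean.PModule H₁) (m₂ : Pythagorean.PModule H₂)
    (h₁ : m₁.IsDiffuse) (h₂ : m₂.IsDiffuse) :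
    (Nontrivial H₁ → ∀ X : Pythagorean.Acting,
      (Pythagorean.IsIrreducible (m₁.rep X) ↔ m₁.IsIndecomposable)) ∧
    (m₁.lim.smallestComplete.IsComplete ∧
      m₁.lim.smallestComplete.carrier ≤ LinearMap.range m₁.embed) ∧
    (m₂.lim.smallestComplete.IsComplete ∧
      m₂.lim.smallestComplete.carrier ≤ LinearMap.range m₂.embed) ∧
    (∀ (X : Pythagorean.Acting) (Θ : m₁.Lim →L[ℂ] m₂.Lim),
      Pythagorean.Intertwines (m₁.rep X) (m₂.rep X) Θ →
        ∃ θ : m₁.lim.smallestComplete.carrier →L[ℂ] m₂.lim.smallestComplete.carrier,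
          Pythagorean.PModule.IsMorphism m₁.lim.smallestComplete.toPModule
            m₂.lim.smallestComplete.toPModule θ ∧
          ∀ x, (θ x : m₂.Lim) = Θ x) ∧
    (∀ X : Pythagorean.Acting,
      (Pythagorean.UnitarilyEquivalent (m₁.rep X) (m₂.rep X) ↔
        Pythagorean.PModule.Equivalent m₁.lim.smallestComplete.toPModule
          m₂.lim.smallestComplete.toPModule)) := by
  have hmor : ∀ (X : Pythagorean.Acting) (Θ : m₁.Lim →L[ℂ] m₂.Lim),
      Pythagorean.Intertwines (m₁.rep X) (m₂.rep X) Θ →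
        ∃ θ : m₁.lim.smallestComplete.carrier →L[ℂ] m₂.lim.smallestComplete.carrier,
          Pythagorean.PModule.IsMorphism m₁.lim.smallestComplete.toPModule
            m₂.lim.smallestComplete.toPModule θ ∧
          ∀ x, (θ x : m₂.Lim) = Θ x := by
    intro X Θ h
    have hS := (h₁.intertwines_rep_iff X Θ).1 h
    have hop := Pythagorean.PModule.map_lim_op_of_map_cuntz_S hS
    refine ⟨(Θ ∘L m₁.lim.smallestComplete.carrier.subtypeL).codRestrict _
      fun x => Pythagorean.PModule.map_smallestComplete_mem hS x.2, ⟨?_, ?_⟩, fun x => rfl⟩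
    · ext x
      exact hop false x
    · ext x
      exact hop true x
  refine ⟨fun _ X => h₁.isIrreducible_rep_iff X,
    ⟨m₁.smallestComplete_isComplete, m₁.smallestComplete_le_range_embed⟩,
    ⟨m₂.smallestComplete_isComplete, m₂.smallestComplete_le_range_embed⟩, hmor, fun X => ?_⟩
  rw [h₁.unitarilyEquivalent_rep_iff]
  exact ⟨fun ⟨U, hU⟩ => Pythagorean.PModule.equivalent_smallestComplete U hU,
    Pythagorean.PModule.exists_unitary_of_equivalent m₁.smallestComplete_isComplete
      m₂.smallestComplete_isComplete⟩
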